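/- **Setting.** Let $\Lambda\subset\mathbb Z^d$ be finite and nonempty, let $\mathcal H_\Lambda=(\mathbb C^q)^{\otimes\Lambda}$, and let $\|\cdot\|$ be the operator norm. For $S\subset\Lambda$ let $\mathcal B_S$ be the operators of the form $1_{\Lambda\setminus S}\otimes O_S$. A potential is a family $Z=(Z_S)$ with $Z_S\in\mathcal B_S$, indexed by the nonempty connected (by nearest-neighbour adjacency) sets $S\subset\Lambda$; its operator is $\sum_S Z_S$, and for $\kappa>0$ $$\|Z\|_\kappa=\sup_{x\in\Lambda}\sum_{S\ni x}e^{\kappa|S|}\|Z_S\| .$$ For each $x\in\Lambda$ let $N_x\in\mathcal B_{\{x\}}$ be Hermitian with spectrum contained in $\mathbb Z$, and let $N=\sum_xN_x$. Let $H$ be a potential whose operator (also denoted $H$) is Hermitian, let $\nu$ be real, $G=\nu N+H$ and $U(t)=e^{-itG}$. For an operator $O$ put $\langle O\rangle=\sum_{n\in\mathbb Z}\chi(N=n)\,O\,\chi(N=n)$, and define potentials $D_S=\langle H_S\rangle$, $V_S=H_S-D_S$. Let $\kappa_0>0$, $$\nu_0=\frac{54\pi}{\kappa_0^2}\big(\|D\|_{\kappa_0}+2\|V\|_{\kappa_0}\big),\qquad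 n_*=\Big\lfloor\frac{\nu/\nu_0}{(1+\ln(\nu/\nu_0))^3}\Big\rfloor-2,$$ and assume (with $\nu_0>0$, so that $n_*$ is defined) $$\nu\ge\frac{9\pi\|V\|_{\kappa_0}}{\kappa_0},\qquad \nu\ge\nu_0,\qquad n_*\ge1 .$$ **Dressed quantities.** Put $H_0=H$, and for $n\ge0$ let $V_n=H_n-\langle H_n\rangle$, $T=2\pi/\nu$, $$A_n=\frac iT\int_0^Tdt\int_0^tds\;e^{is\nu N}V_ne^{-is\nu N},\qquad \nu N+H_{n+1}=e^{-A_n}(\nu N+H_n)e^{A_n},$$ so that $[\nu N,A_n]+V_n=0$ and $A_n$ is anti-Hermitian. Stop after $k$ steps, where $k=n_*$ or $k=n_*+1$ (the result holds for both choices), and put $$Y=e^{-A_{k-1}}\cdots e^{-A_0},\qquad \widehat D=\langle H_k\rangle,\qquad \mathcal D=Y^*\widehat DY,\qquad \mathcal N=Y^*NY .$$ **Theorem 5.** There is a numerical constant $C>0$, independent of all model parameters (in particular of $d$, $q$, $\Lambda$, $N_x$, $H$, $\kappa_0$, $\nu$, $k$), such that under these assumptions, for all $t\ge0$, $$\frac1{|\Lambda|}\|U^*(t)\,\mathcal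 D\,U(t)-\mathcal D\|\le t\,K_0\,(2/3)^{n_*},\qquad \frac1{|\Lambda|}\|U^*(t)\,\mathcal N\,U(t)-\mathcal N\|\le t\,K_0'\,(2/3)^{n_*},$$ with $$K_0=C\Big(\|D\|_{\kappa_0}+\frac{\nu_0}{\nu}\|V\|_{\kappa_0}\Big)\|V\|_{\kappa_0}\;\le\;C\big(\|D\|_{\kappa_0}+\|V\|_{\kappa_0}\big)\|V\|_{\kappa_0},\qquad K_0'=C\,\big(\sup_x\|N_x\|\big)\,\|V\|_{\kappa_0}.$$ This applies to the doublon number in the Fermi–Hubbard chain with $U\gg J$: let $\Lambda\subset\mathbb Z$ be finite, containing at least one pair of neighbours, realize the fermionic operators $c_{x,\sigma}$ ($\sigma\in\{\uparrow,\downarrow\}$) on $(\mathbb C^4)^{\otimes\Lambda}$ by the Jordan–Wigner representation in the lexicographic order of the modes $(x,\sigma)$, and let $\nu=U$, $N_x=n_{x,\downarrow}n_{x,\uparrow}$ and $H=J\sum_{x\sim y,\sigma}c_{x,\sigma}c^*_{y,\sigma}$ (sum over ordered pairs of neighbours, with the terms of the bond $\{x,y\}$ collected in $H_{\{x,y\}}$).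 For every $\kappa_0>0$ there is $c>0$, independent of $\Lambda,J,U$, such that all the assumptions above hold whenever $J\ne0$ and $U\ge c|J|$. -/

import Mathlib

open scoped Matrix.Norms.L2Operator

noncomputable section

namespace Prethermal

/-! ### Spin systems on finite subsets of `ℤ^d` -/

/-- The nearest-neighbour graph of `ℤ^d`: two sites are adjacent iff their `ℓ¹` distance is `1`. -/
def latticeGraph (d : ℕ) : SimpleGraph (Fin d → ℤ) where
  Adj x y := ∑ i, |x i - y i| = 1
  symm := ⟨fun x y h => by simpa only [abs_sub_comm] using h⟩
  loopless := ⟨fun x h => by simp at h⟩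

/-- A volume `Λ`, that is, a finite set of sites. -/
abbrev Volume (d : ℕ) := Finset (Fin d → ℤ)

/-- Connectedness by adjacency of a (nonempty) set of sites of `Λ`. -/
def IsConn {d : ℕ} {Λ : Volume d} (S : Finset Λ) : Prop :=
  (((latticeGraph d).comap (Subtype.val : Λ → Fin d → ℤ)).induce (S : Set Λ)).Connected

/-- The operators on the Hilbert space `(ℂ^q)^{⊗ Λ}`, written as matrices in the product basis,
which is labelled by the configurations `Λ → Fin q`. They carry the operator norm induced by the
Hilbert space norm. -/
abbrev Op {d : ℕ} (q : ℕ) (Λ : Volume d) := Matrix (Λ → Fin q) (Λ → Fin q) ℂ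

/-- The operator `1_{Λ ∖ S} ⊗ O` for an operator `O` on `(ℂ^q)^{⊗ S}`. -/
def embed {d q : ℕ} {Λ : Volume d} (S : Finset Λ)
    (O : Matrix (S → Fin q) (S → Fin q) ℂ) : Op q Λ :=
  open Classical in
  Matrix.of fun η η' =>
    if ∀ x, x ∉ S → η x = η' x then O (fun x => η x) (fun x => η' x) else 0

/-- The operator `M` acts within `S`. -/
def ActsWithin {d q : ℕ} {Λ : Volume d} (S : Finset Λ) (M : Op q Λ) : Prop :=
  ∃ O : Matrix (S → Fin q) (S → Fin q) ℂ, M = embed S O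

/-- A potential: a family of operators `Z S` acting within `S`, indexed by the connected `S`
(the terms at sets that are not connected are zero). -/
structure IsPotential {d q : ℕ} {Λ : Volume d} (Z : Finset Λ → Op q Λ) : Prop where
  actsWithin : ∀ S, ActsWithin S (Z S)
  eq_zero : ∀ S, ¬ IsConn S → Z S = 0

/-- The operator `∑_S Z_S` of a potential. -/
def total {d q : ℕ} {Λ : Volume d} (Z : Finset Λ → Op q Λ) : Op q Λ :=
  ∑ S, Z S

/-- The norm `‖Z‖_κ = sup_x ∑_{S ∋ x} e^{κ |S|} ‖Z_S‖` of a potential. -/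
def potNorm {d q : ℕ} {Λ : Volume d} (κ : ℝ) (Z : Finset Λ → Op q Λ) : ℝ :=
  open Classical in
  ⨆ x : Λ, ∑ S : Finset Λ with IsConn S ∧ x ∈ S, Real.exp (κ * (S.card : ℝ)) * ‖Z S‖

/-! ### Averaging with respect to a number operator -/

/-- The spectral projection `χ(N = n)` of a Hermitian operator `N`. -/
def spectralProj {d q : ℕ} {Λ : Volume d} (N : Op q Λ) (n : ℤ) : Op q Λ :=
  cfc (fun z : ℝ => if z = (n : ℝ) then (1 : ℝ) else 0) N

/-- The diagonal part `⟨O⟩ = ∑_n χ(N = n) O χ(N = n)`; only finitely many terms are nonzero. -/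
def average {d q : ℕ} {Λ : Volume d} (N O : Op q Λ) : Op q Λ :=
  ∑ᶠ n : ℤ, spectralProj N n * O * spectralProj N n

/-- The potential `D_S = ⟨H_S⟩`. -/
def diagPart {d q : ℕ} {Λ : Volume d} (N : Op q Λ) (H : Finset Λ → Op q Λ) :
    Finset Λ → Op q Λ :=
  fun S => average N (H S)

/-- The potential `V_S = H_S - D_S`. -/
def offDiagPart {d q : ℕ} {Λ : Volume d} (N : Op q Λ) (H : Finset Λ → Op q Λ) :
    Finset Λ → Op q Λ :=
  fun S => H S - average N (H S)

/-! ### The renormalization scheme -/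

/-- The anti-Hermitian solution `A` of `[ν N, A] + V = 0` given by
`A = (i/T) ∫_0^T dt ∫_0^t ds e^{i s ν N} V e^{-i s ν N}` with `T = 2π/ν`, for `⟨V⟩ = 0`. -/
def generator {d q : ℕ} {Λ : Volume d} (ν : ℝ) (N V : Op q Λ) : Op q Λ :=
  (Complex.I * ((ν / (2 * Real.pi) : ℝ) : ℂ)) •
    ∫ t in (0 : ℝ)..(2 * Real.pi / ν), ∫ s in (0 : ℝ)..t,
      NormedSpace.exp ((Complex.I * ((s * ν : ℝ) : ℂ)) • N) * V *
        NormedSpace.exp ((-(Complex.I * ((s * ν : ℝ) : ℂ))) • N)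

/-- The Hamiltonians `H_n`: `H_0 = H` and
`e^{-A_n} (ν N + H_n) e^{A_n} = ν N + H_{n+1}`, where `A_n` is the generator for
`V_n = H_n - ⟨H_n⟩`. -/
def renHam {d q : ℕ} {Λ : Volume d} (ν : ℝ) (N H : Op q Λ) : ℕ → Op q Λ
  | 0 => H
  | n + 1 =>
    NormedSpace.exp (-generator ν N (renHam ν N H n - average N (renHam ν N H n))) *
      ((ν : ℂ) • N + renHam ν N H n) *
      NormedSpace.exp (generator ν N (renHam ν N H n - average N (renHam ν N H n))) - (ν : ℂ) • N

/-- The generator `A_n` of the `n`-th step. -/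
def renGen {d q : ℕ} {Λ : Volume d} (ν : ℝ) (N H : Op q Λ) (n : ℕ) : Op q Λ :=
  generator ν N (renHam ν N H n - average N (renHam ν N H n))

/-- The effective Hamiltonian `D̂ = ⟨H_k⟩` after `k` steps. -/
def effHam {d q : ℕ} {Λ : Volume d} (ν : ℝ) (N H : Op q Λ) (k : ℕ) : Op q Λ :=
  average N (renHam ν N H k)

/-- The unitary `Y = e^{-A_{k-1}} ⋯ e^{-A_0}` of `k` steps, so that
`Y (ν N + H) Y* = ν N + H_k`. -/
def dressing {d q : ℕ} {Λ : Volume d} (ν : ℝ) (N H : Op q Λ) : ℕ → Op q Λ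
  | 0 => 1
  | k + 1 => NormedSpace.exp (-renGen ν N H k) * dressing ν N H k

/-- The dressed version `Y* O Y` of an operator `O`, after `k` steps. -/
def dressed {d q : ℕ} {Λ : Volume d} (ν : ℝ) (N H : Op q Λ) (k : ℕ) (O : Op q Λ) : Op q Λ :=
  star (dressing ν N H k) * O * dressing ν N H k

/-- The time evolution `U(t) = e^{-i t G}` generated by `G = ν N + H`. -/
def evolution {d q : ℕ} {Λ : Volume d} (ν : ℝ) (N H : Op q Λ) (t : ℝ) : Op q Λ :=
  NormedSpace.exp ((-(Complex.I * (t : ℂ))) • ((ν : ℂ) • N + H))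

/-! ### Energy scales and standing assumptions -/

/-- `ν₀ = (54 π / κ₀²) (‖D‖_{κ₀} + 2 ‖V‖_{κ₀})`. -/
def nuZero {d q : ℕ} {Λ : Volume d} (κ₀ : ℝ) (N : Op q Λ) (H : Finset Λ → Op q Λ) : ℝ :=
  54 * Real.pi / κ₀ ^ 2 * (potNorm κ₀ (diagPart N H) + 2 * potNorm κ₀ (offDiagPart N H))

/-- `n_* = ⌊(ν/ν₀) / (1 + ln(ν/ν₀))³⌋ - 2`. -/
def nStar (ν ν₀ : ℝ) : ℤ :=
  ⌊(ν / ν₀) / (1 + Real.log (ν / ν₀)) ^ 3⌋ - 2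

/-- A family of number operators: Hermitian on-site operators with integer spectrum. -/
structure IsNumberFamily {d q : ℕ} {Λ : Volume d} (Nx : Λ → Op q Λ) : Prop where
  actsWithin : ∀ x, ActsWithin {x} (Nx x)
  isHermitian : ∀ x, (Nx x).IsHermitian
  spectrum_subset : ∀ x, spectrum ℂ (Nx x) ⊆ Set.range fun n : ℤ => (n : ℂ)

/-- The standing assumptions on `G = ν ∑_x N_x + ∑_S H_S`, with decay rate `κ₀`. -/
structure Admissible {d q : ℕ} {Λ : Volume d} (Nx : Λ → Op q Λ) (H : Finset Λ → Op q Λ)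
    (κ₀ ν : ℝ) : Prop where
  number : IsNumberFamily Nx
  potential : IsPotential H
  isHermitian : (total H).IsHermitian
  decay_pos : 0 < κ₀
  scale_V : 9 * Real.pi * potNorm κ₀ (offDiagPart (∑ x, Nx x) H) / κ₀ ≤ ν
  scale_nuZero : nuZero κ₀ (∑ x, Nx x) H ≤ ν
  one_le_nStar : 1 ≤ nStar ν (nuZero κ₀ (∑ x, Nx x) H)

/-! ### The Fermi–Hubbard chain

A site carries one of the four states with occupation numbers `(n_↑, n_↓)`; the state `a : Fin 4`
has the binary digits `n_↑` (digit `0`) and `n_↓` (digit `1`). The field operators are realized on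
`(ℂ^4)^{⊗ Λ}` by the Jordan–Wigner representation for the lexicographic order of the modes
`(x, σ)`. -/

/-- The occupation of the mode `σ` in the single-site state `a`. -/
def occ (a : Fin 4) (σ : Fin 2) : Bool := a.val.testBit σ.val

/-- The number of occupied modes that precede the mode `(x, σ)` in the configuration `η`. -/
def occBefore {Λ : Volume 1} (η : Λ → Fin 4) (x : Λ) (σ : Fin 2) : ℕ :=
  (Finset.univ.filter fun p : Λ × Fin 2 =>
    (p.1.val 0 < x.val 0 ∨ (p.1 = x ∧ p.2 < σ)) ∧ occ (η p.1) p.2 = true).card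

/-- The annihilation operator `c_{x,σ}`. -/
def annih {Λ : Volume 1} (x : Λ) (σ : Fin 2) : Op 4 Λ :=
  open Classical in
  Matrix.of fun η' η =>
    if occ (η x) σ = true ∧ occ (η' x) σ = false ∧
        (∀ y τ, (y, τ) ≠ (x, σ) → occ (η' y) τ = occ (η y) τ) then
      (-1 : ℂ) ^ occBefore η x σ
    else 0

/-- The doublon number `N_x = n_{x,↓} n_{x,↑}` with `n_{x,σ} = c*_{x,σ} c_{x,σ}`. -/
def doublon {Λ : Volume 1} (x : Λ) : Op 4 Λ :=
  (star (annih x 1) * annih x 1) * (star (annih x 0) * annih x 0)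

/-- The potential of the hopping term `J ∑_{x ∼ y, σ} c_{x,σ} c*_{y,σ}` (the sum runs over ordered
pairs of neighbours); the terms of the bond `{x, y}` are collected at `S = {x, y}`. -/
def hopping {Λ : Volume 1} (J : ℝ) (S : Finset Λ) : Op 4 Λ :=
  open Classical in
  (J : ℂ) • ∑ x : Λ, ∑ y : Λ,
    if (latticeGraph 1).Adj x.val y.val ∧ S = {x, y} then
      ∑ σ : Fin 2, annih x σ * star (annih y σ)
    else 0

end Prethermal

end

namespace Prethermal

set_option linter.unusedSectionVars false

variable {d q : ℕ} {Λ : Volume d}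

/-! ### Locality of operators -/

/-! One step of the scheme conjugates by `e^{-A}`, where `A` solves `[νN, A] = -V`. The first-order
term of the Lie series then cancels `V`, and `νN + D + V` becomes `νN + D + W`, where `W` contains
only commutators of `D` and `V` with `A`. Since `‖A‖ ≤ (π/ν)‖V‖`, `W` is smaller than `V` by a
factor of order `(‖D‖ + ‖V‖)/ν`. The estimate has to be uniform in the volume, so it is made on
potentials, where a commutator costs decay rate (`potNorm_comm_le`). The whole series costs a fixed
loss `κ - κ'`, because `m^m / m! ≤ e^m` absorbs the splitting of the loss into `m` pieces
(`potNorm_commCLM_pow_le`, `potNorm_remainder_le`).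

The first step lowers the rate from `κ₀` to `κ₀/3` and gains a factor of order `ν₀/ν`. The remaining
steps share a further loss of `κ₀/6` equally, so the rate never falls below `κ₀/6`, and each
multiplies the bound on the off-diagonal part by `2/3`. This works for `k` steps as long as `24 k ≤
ν/ν₀` (`potNorm_renPot_le`), and `n_* ≥ 1` forces `ν/ν₀` to be large enough for this
(`ratio_bounds`).

Averages and generators are integrals of `e^{isN} O e^{-isN}`. These rotations are isometric,
`2π`-periodic because `N` has integer spectrum, and preserve the support of `O` because `N` is a sum
of commuting on-site terms. This yields the norm bounds and the locality of `D`, `V` and `A`.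

For `O` commuting with `N`, the commutator of `G` with `Y* O Y` is `Y* [H_k, O] Y`. For `O = N` or
`O = ⟨H_k⟩` only `V_k` contributes to `[H_k, O]`, so the drift up to time `t` is at most `t` times
the norm of `[V_k, O]` (`IsNumberOp.norm_dressed_sub_le`). That norm is at most `|Λ|` times norms of
potentials, since only overlapping terms fail to commute.

For the Hubbard chain, Jordan–Wigner strings of neighbours cancel up to modes on the bond, so the
hopping is a potential of norm `O(|J|)`. It does not vanish, hence `ν₀ > 0`, and `(1 + log r)³ =
o(r)` gives `n_* ≥ 1` for large `U/|J|`. -/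

open Classical in
theorem embed_apply (S : Finset Λ) (O : Matrix (S → Fin q) (S → Fin q) ℂ) (η η' : Λ → Fin q) :
    embed S O η η' =
      if ∀ x, x ∉ S → η x = η' x then O (fun x => η x) (fun x => η' x) else 0 := by
  simp only [embed, Matrix.of_apply]

/-- The configuration that equals `η` on `S` and `η'` off `S`. -/
def glue (S : Finset Λ) (η η' : Λ → Fin q) : Λ → Fin q :=
  open Classical in fun x => if x ∈ S then η x else η' x

theorem glue_of_mem {S : Finset Λ} (η η' : Λ → Fin q) {x : Λ} (h : x ∈ S) :
    glue S η η' x = η x := by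
  simp [glue, h]

theorem glue_of_notMem {S : Finset Λ} (η η' : Λ → Fin q) {x : Λ} (h : x ∉ S) :
    glue S η η' x = η' x := by
  simp [glue, h]

/-- Extension of a configuration on `S` by `η` off `S`. -/
def extendConf (S : Finset Λ) (η : Λ → Fin q) (ξ : S → Fin q) : Λ → Fin q :=
  open Classical in fun x => if h : x ∈ S then ξ ⟨x, h⟩ else η x

theorem embed_mul (S : Finset Λ) (A B : Matrix (S → Fin q) (S → Fin q) ℂ) :
    embed S A * embed S B = embed S (A * B) := by
  classical
  ext η η'
  rw [Matrix.mul_apply, embed_apply]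
  split_ifs with h
  · rw [Matrix.mul_apply]
    symm
    -- Only intermediate configurations that agree with `η` off `S` contribute; they are
    -- parametrized by their restrictions to `S`.
    refine Finset.sum_of_injOn (fun ξ => extendConf S η ξ) ?_ ?_ ?_ ?_
    · intro ξ _ ξ' _ hξ
      funext y
      have := congrFun hξ y.1
      simpa [extendConf] using this
    · intro ξ _; simp
    · intro ζ _ hζ
      rw [embed_apply]
      split_ifs with h1
      · exfalso
        apply hζ
        refine ⟨fun y => ζ y, by simp, ?_⟩
        funext x
        by_cases hx : x ∈ S
        · simp [extendConf, hx]
        · simp [extendConf, hx, h1 x hx]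
      · simp
    · intro ξ _
      have e1 : ∀ x, x ∉ S → η x = extendConf S η ξ x := fun x hx => by simp [extendConf, hx]
      have e2 : ∀ x, x ∉ S → extendConf S η ξ x = η' x := fun x hx => by
        rw [← e1 x hx, h x hx]
      have e3 : (fun x : S => extendConf S η ξ x) = ξ := by
        funext y; simp [extendConf]
      rw [embed_apply, embed_apply, if_pos e1, if_pos e2, e3]
  · refine Finset.sum_eq_zero fun ζ _ => ?_
    rw [embed_apply, embed_apply]
    split_ifs with h1 h2
    · exact absurd (fun x hx => (h1 x hx).trans (h2 x hx)) h
    all_goals simp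

theorem embed_add (S : Finset Λ) (A B : Matrix (S → Fin q) (S → Fin q) ℂ) :
    embed S (A + B) = embed S A + embed S B := by
  classical
  ext η η'
  simp only [embed_apply, Matrix.add_apply]
  split_ifs <;> simp

theorem embed_smul (S : Finset Λ) (c : ℂ) (A : Matrix (S → Fin q) (S → Fin q) ℂ) :
    embed S (c • A) = c • embed S A := by
  classical
  ext η η'
  simp only [embed_apply, Matrix.smul_apply]
  split_ifs <;> simp

theorem embed_one (S : Finset Λ) : embed S (1 : Matrix (S → Fin q) (S → Fin q) ℂ) = 1 := by
  classical
  ext η η'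
  simp only [embed_apply, Matrix.one_apply]
  by_cases h : η = η'
  · subst h; simp
  · rw [if_neg h]
    split_ifs with h1 h2
    · exact absurd (funext fun x => by
        by_cases hx : x ∈ S
        · exact congrFun h2 ⟨x, hx⟩
        · exact h1 x hx) h
    all_goals rfl

/-- The algebra of operators acting within `S`. -/
def localAlg (q : ℕ) (S : Finset Λ) : Subalgebra ℂ (Op q Λ) where
  carrier := {M | ActsWithin S M}
  mul_mem' := by
    rintro _ _ ⟨A, rfl⟩ ⟨B, rfl⟩
    exact ⟨_, embed_mul S A B⟩
  add_mem' := by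
    rintro _ _ ⟨A, rfl⟩ ⟨B, rfl⟩
    exact ⟨_, (embed_add S A B).symm⟩
  algebraMap_mem' c := ⟨c • 1, by rw [embed_smul, embed_one, Algebra.algebraMap_eq_smul_one]⟩

theorem mem_localAlg {S : Finset Λ} {M : Op q Λ} : M ∈ localAlg q S ↔ ActsWithin S M := Iff.rfl

/-- Closedness keeps limits local: exponentials and sums of Lie series of operators in `localAlg q
S` stay there. -/
theorem isClosed_localAlg (S : Finset Λ) : IsClosed (localAlg q S : Set (Op q Λ)) :=
  Submodule.closed_of_finiteDimensional (Subalgebra.toSubmodule (localAlg q S))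

theorem ActsWithin.mono {S T : Finset Λ} (hST : S ⊆ T) {M : Op q Λ} (h : ActsWithin S M) :
    ActsWithin T M := by
  classical
  obtain ⟨O, rfl⟩ := h
  refine ⟨Matrix.of fun ξ ξ' => if ∀ x : T, x.1 ∉ S → ξ x = ξ' x then
    O (fun x => ξ ⟨x, hST x.2⟩) (fun x => ξ' ⟨x, hST x.2⟩) else 0, ?_⟩
  ext η η'
  simp only [embed_apply, Matrix.of_apply]
  by_cases h : ∀ x, x ∉ S → η x = η' x
  · rw [if_pos h, if_pos (fun x hx => h x fun hx' => hx (hST hx')),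
      if_pos (fun (x : T) hx => h x.1 hx)]
  · rw [if_neg h]
    split_ifs with h1 h2
    · refine absurd (fun x hx => ?_) h
      by_cases hT : x ∈ T
      · exact h2 ⟨x, hT⟩ hx
      · exact h1 x hT
    all_goals rfl

theorem ActsWithin.commute {S T : Finset Λ} (hST : Disjoint S T) {M M' : Op q Λ}
    (h : ActsWithin S M) (h' : ActsWithin T M') : Commute M M' := by
  classical
  obtain ⟨A, rfl⟩ := h
  obtain ⟨B, rfl⟩ := h'
  have key : ∀ {S T : Finset Λ} (_ : Disjoint S T) (A : Matrix (S → Fin q) (S → Fin q) ℂ)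
      (B : Matrix (T → Fin q) (T → Fin q) ℂ) (η η' : Λ → Fin q),
      (embed S A * embed T B) η η' =
        if ∀ x, x ∉ S → x ∉ T → η x = η' x then
          A (fun x => η x) (fun x => η' x) * B (fun x => η x) (fun x => η' x) else 0 := by
    intro S T hST A B η η'
    have hd : ∀ x, x ∈ S → x ∉ T := fun x hx => Finset.disjoint_left.1 hST hx
    rw [Matrix.mul_apply, Finset.sum_eq_single (glue S η' η)]
    -- In the matrix product only one intermediate configuration survives: `η'` on `S` and `η`
    -- elsewhere. The entry therefore factorizes, and the resulting formula is symmetric in the two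
    -- factors.
    · have e1 : (fun x : S => glue S η' η x) = fun x : S => η' x :=
        funext fun x => glue_of_mem _ _ x.2
      have e2 : (fun x : T => glue S η' η x) = fun x : T => η x :=
        funext fun x => glue_of_notMem _ _ fun h => hd _ h x.2
      have e3 : ∀ x, x ∉ S → η x = glue S η' η x := fun x hx => (glue_of_notMem _ _ hx).symm
      rw [embed_apply, embed_apply, e1, e2, if_pos e3]
      by_cases h : ∀ x, x ∉ S → x ∉ T → η x = η' x
      · rw [if_pos h, if_pos]
        intro x hx
        by_cases hS : x ∈ S
        · exact glue_of_mem _ _ hS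
        · rw [← e3 x hS, h x hS hx]
      · rw [if_neg h, if_neg, mul_zero]
        intro h2
        exact h fun x hS hT => (e3 x hS).trans (h2 x hT)
    · intro ζ _ hζ
      rw [embed_apply, embed_apply]
      split_ifs with h1 h2
      · refine absurd (funext fun x => ?_) hζ
        by_cases hS : x ∈ S
        · rw [glue_of_mem _ _ hS, h2 x (hd x hS)]
        · rw [glue_of_notMem _ _ hS, h1 x hS]
      all_goals simp
    · intro h; exact absurd (Finset.mem_univ _) h
  ext η η'
  rw [key hST, key hST.symm]
  refine if_congr ⟨fun h x hT hS => h x hS hT, fun h x hT hS => h x hS hT⟩ (mul_comm _ _) rfl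

/-! ### Commutators of potentials -/

theorem IsConn.union {S T : Finset Λ} (hS : IsConn S) (hT : IsConn T) (h : ¬ Disjoint S T) :
    IsConn (S ∪ T) := by
  unfold IsConn at *
  rw [Finset.coe_union]
  refine SimpleGraph.induce_union_connected hS.preconnected hT.preconnected ?_
  rw [← Finset.coe_inter, Finset.coe_nonempty, Finset.nonempty_iff_ne_empty]
  exact fun h' => h (Finset.disjoint_iff_inter_eq_empty.2 h')

/-- The potential of the commutator of the operators of two potentials. -/
def comm (A Z : Finset Λ → Op q Λ) (P : Finset Λ) : Op q Λ :=
  open Classical in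
  ∑ S, ∑ T, if S ∪ T = P ∧ ¬ Disjoint S T then A S * Z T - Z T * A S else 0

theorem isPotential_comm {A Z : Finset Λ → Op q Λ} (hA : IsPotential A) (hZ : IsPotential Z) :
    IsPotential (comm A Z) where
  actsWithin P := by
    rw [← mem_localAlg]
    refine sum_mem fun S _ => sum_mem fun T _ => ?_
    split_ifs with h
    · have h1 := mem_localAlg.2 ((hA.actsWithin S).mono (h.1 ▸ Finset.subset_union_left))
      have h2 := mem_localAlg.2 ((hZ.actsWithin T).mono (h.1 ▸ Finset.subset_union_right))
      exact sub_mem (mul_mem h1 h2) (mul_mem h2 h1)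
    · exact zero_mem _
  eq_zero P hP := by
    refine Finset.sum_eq_zero fun S _ => Finset.sum_eq_zero fun T _ => ?_
    split_ifs with h
    · by_cases hS : IsConn S
      · by_cases hT : IsConn T
        · exact absurd (h.1 ▸ hS.union hT h.2) hP
        · simp [hZ.eq_zero T hT]
      · simp [hA.eq_zero S hS]
    · rfl

/-- Pairs with disjoint supports, which `comm` omits, have vanishing commutators. -/
theorem total_comm {A Z : Finset Λ → Op q Λ} (hA : IsPotential A) (hZ : IsPotential Z) :
    total (comm A Z) = total A * total Z - total Z * total A := by
  classical
  simp only [total, comm]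
  rw [Finset.sum_comm]
  simp_rw [Finset.sum_mul, Finset.mul_sum]
  rw [Finset.sum_comm (f := fun i j => Z i * A j), ← Finset.sum_sub_distrib]
  refine Finset.sum_congr rfl fun S _ => ?_
  rw [Finset.sum_comm, ← Finset.sum_sub_distrib]
  refine Finset.sum_congr rfl fun T _ => ?_
  by_cases h : Disjoint S T
  · simp [h, ((hA.actsWithin S).commute h (hZ.actsWithin T)).eq]
  · simp [h]

/-! ### The norms of potentials -/

/-- The sum in the definition of `potNorm`, at the site `x`. -/
noncomputable def siteSum (κ : ℝ) (x : Λ) (Z : Finset Λ → Op q Λ) : ℝ :=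
  open Classical in
  ∑ S : Finset Λ, if x ∈ S then Real.exp (κ * (S.card : ℝ)) * ‖Z S‖ else 0

/-- `siteSum` drops the restriction to connected sets, which costs nothing because a potential
vanishes on the others. -/
theorem siteSum_eq {Z : Finset Λ → Op q Λ} (hZ : IsPotential Z) (κ : ℝ) (x : Λ) :
    open Classical in
    ∑ S : Finset Λ with IsConn S ∧ x ∈ S, Real.exp (κ * (S.card : ℝ)) * ‖Z S‖
      = siteSum κ x Z := by
  classical
  rw [siteSum, Finset.sum_filter]
  refine Finset.sum_congr rfl fun S _ => ?_
  by_cases hS : IsConn S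
  · simp [hS]
  · simp [hS, hZ.eq_zero S hS]

theorem siteSum_le {Z : Finset Λ → Op q Λ} (hZ : IsPotential Z) (κ : ℝ) (x : Λ) :
    siteSum κ x Z ≤ potNorm κ Z := by
  classical
  rw [← siteSum_eq hZ]
  exact le_ciSup (f := fun x : Λ => ∑ S : Finset Λ with IsConn S ∧ x ∈ S,
    Real.exp (κ * (S.card : ℝ)) * ‖Z S‖) (Set.finite_range _).bddAbove x

theorem potNorm_le [Nonempty Λ] {Z : Finset Λ → Op q Λ} (hZ : IsPotential Z) {κ c : ℝ}
    (h : ∀ x, siteSum κ x Z ≤ c) : potNorm κ Z ≤ c := by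
  classical
  refine ciSup_le fun x => ?_
  rw [siteSum_eq hZ]
  exact h x

theorem siteSum_nonneg (κ : ℝ) (x : Λ) (Z : Finset Λ → Op q Λ) : 0 ≤ siteSum κ x Z := by
  classical
  refine Finset.sum_nonneg fun S _ => ?_
  split_ifs <;> positivity

theorem potNorm_nonneg (κ : ℝ) (Z : Finset Λ → Op q Λ) : 0 ≤ potNorm κ Z := by
  classical
  exact Real.iSup_nonneg fun x => Finset.sum_nonneg fun S _ => by positivity

theorem siteSum_mono {κ κ' : ℝ} (h : κ' ≤ κ) (x : Λ) {Z Z' : Finset Λ → Op q Λ}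
    (hZ : ∀ S, ‖Z' S‖ ≤ ‖Z S‖) : siteSum κ' x Z' ≤ siteSum κ x Z := by
  classical
  refine Finset.sum_le_sum fun S _ => ?_
  split_ifs
  · have := hZ S
    gcongr
  · rfl

theorem potNorm_mono [Nonempty Λ] {κ κ' c : ℝ} (h : κ' ≤ κ) {Z Z' : Finset Λ → Op q Λ}
    (hp : IsPotential Z) (hp' : IsPotential Z') (hc : 0 ≤ c) (hZ : ∀ S, ‖Z' S‖ ≤ c * ‖Z S‖) :
    potNorm κ' Z' ≤ c * potNorm κ Z := by
  classical
  refine potNorm_le hp' fun x => ?_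
  refine le_trans ?_ (mul_le_mul_of_nonneg_left (siteSum_le hp κ x) hc)
  rw [siteSum, siteSum, Finset.mul_sum]
  refine Finset.sum_le_sum fun S _ => ?_
  split_ifs
  · have := hZ S
    calc Real.exp (κ' * S.card) * ‖Z' S‖ ≤ Real.exp (κ * S.card) * (c * ‖Z S‖) := by gcongr
      _ = _ := by ring
  · simp

theorem siteSum_add_le (κ : ℝ) (x : Λ) (Z Z' : Finset Λ → Op q Λ) :
    siteSum κ x (Z + Z') ≤ siteSum κ x Z + siteSum κ x Z' := by
  classical
  rw [siteSum, siteSum, siteSum, ← Finset.sum_add_distrib]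
  refine Finset.sum_le_sum fun S _ => ?_
  split_ifs
  · rw [← mul_add]
    gcongr
    exact norm_add_le _ _
  · simp

theorem siteSum_smul (κ : ℝ) (x : Λ) (c : ℂ) (Z : Finset Λ → Op q Λ) :
    siteSum κ x (c • Z) = ‖c‖ * siteSum κ x Z := by
  classical
  rw [siteSum, siteSum, Finset.mul_sum]
  refine Finset.sum_congr rfl fun S _ => ?_
  split_ifs
  · rw [Pi.smul_apply, norm_smul]; ring
  · simp

theorem continuous_siteSum (κ : ℝ) (x : Λ) :
    Continuous fun Z : Finset Λ → Op q Λ => siteSum κ x Z := by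
  classical
  unfold siteSum
  refine continuous_finsetSum _ fun S _ => ?_
  split_ifs
  · fun_prop
  · exact continuous_const

theorem potNorm_add_le [Nonempty Λ] (κ : ℝ) {Z Z' : Finset Λ → Op q Λ} (hZ : IsPotential Z)
    (hZ' : IsPotential Z') (hs : IsPotential (Z + Z')) :
    potNorm κ (Z + Z') ≤ potNorm κ Z + potNorm κ Z' :=
  potNorm_le hs fun x => (siteSum_add_le κ x Z Z').trans
    (add_le_add (siteSum_le hZ κ x) (siteSum_le hZ' κ x))

/-- Summation over the pairs of sets that meet, the first one satisfying `P`. -/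
theorem sum_overlap_le {f g : Finset Λ → ℝ} (hf : ∀ S, 0 ≤ f S) (hg : ∀ S, 0 ≤ g S) {M : ℝ}
    (P : Finset Λ → Prop) [DecidablePred P] [DecidableEq Λ]
    (hM : ∀ y : Λ, ∑ T, (if y ∈ T then g T else 0) ≤ M) :
    ∑ S, ∑ T, (if P S ∧ ¬ Disjoint S T then f S * g T else 0)
      ≤ (∑ S, if P S then (S.card : ℝ) * f S else 0) * M := by
  rw [Finset.sum_mul]
  refine Finset.sum_le_sum fun S _ => ?_
  by_cases hS : P S
  · simp only [hS, true_and, if_true]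
    -- A pair that meets is charged to a common site `y ∈ S`; the sum over these sites produces the
    -- factor `|S|`.
    calc ∑ T, (if ¬ Disjoint S T then f S * g T else 0)
        ≤ ∑ T, ∑ y ∈ S, f S * (if y ∈ T then g T else 0) := by
          refine Finset.sum_le_sum fun T _ => ?_
          have h0 : ∀ y ∈ S, 0 ≤ f S * (if y ∈ T then g T else 0) := fun y _ =>
            mul_nonneg (hf S) (by split_ifs; exacts [hg T, le_rfl])
          by_cases h : Disjoint S T
          · rw [if_neg (not_not_intro h)]
            exact Finset.sum_nonneg h0
          · rw [if_pos h]
            obtain ⟨y, hyS, hyT⟩ := Finset.not_disjoint_iff.1 h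
            refine le_trans (le_of_eq ?_) (Finset.single_le_sum h0 hyS)
            simp [hyT]
      _ = ∑ y ∈ S, f S * ∑ T, (if y ∈ T then g T else 0) := by
          rw [Finset.sum_comm]
          simp_rw [Finset.mul_sum]
      _ ≤ ∑ y ∈ S, f S * M :=
          Finset.sum_le_sum fun y _ => mul_le_mul_of_nonneg_left (hM y) (hf S)
      _ = _ := by rw [Finset.sum_const, nsmul_eq_mul]; ring
  · simp [hS]

/-- The maximum of `u e^{-δu}` is `1/(eδ)`; this trades the factor `|S|` from counting overlaps for
a loss of decay rate `δ`. It comes from `δu ≤ e^{δu - 1}`. -/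
theorem mul_exp_le {κ κ' : ℝ} (h : κ' < κ) (u : ℝ) :
    u * Real.exp (κ' * u) ≤ (1 / (Real.exp 1 * (κ - κ'))) * Real.exp (κ * u) := by
  have h1 := Real.add_one_le_exp ((κ - κ') * u - 1)
  have h2 : Real.exp (κ * u) = Real.exp ((κ - κ') * u - 1) * Real.exp 1 * Real.exp (κ' * u) := by
    rw [← Real.exp_add, ← Real.exp_add]; ring_nf
  have hd : 0 < κ - κ' := sub_pos.2 h
  rw [h2]
  have : (1 / (Real.exp 1 * (κ - κ'))) *
      (Real.exp ((κ - κ') * u - 1) * Real.exp 1 * Real.exp (κ' * u))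
      = Real.exp ((κ - κ') * u - 1) / (κ - κ') * Real.exp (κ' * u) := by
    field_simp
  rw [this]
  gcongr
  rw [le_div_iff₀ hd]
  linarith

/-- If `S` and `T` meet then `|S ∪ T| ≤ |S| + |T| - 1`, so the exponential weight factorizes with a
gain `e^{-κ'}`. The site `x` lies in `S` or in `T`; the sum over the other set costs the cardinality
of the one containing `x`, which `mul_exp_le` absorbs. The 4 is 2 for the commutator times 2 for
these cases. -/
theorem potNorm_comm_le [Nonempty Λ] {κ κ' : ℝ} (h : κ' < κ) (hκ' : 0 ≤ κ')
    {A Z : Finset Λ → Op q Λ} (hA : IsPotential A) (hZ : IsPotential Z) :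
    potNorm κ' (comm A Z) ≤
      4 / (Real.exp 1 * (κ - κ')) * Real.exp (-κ') * potNorm κ A * potNorm κ Z := by
  classical
  refine potNorm_le (isPotential_comm hA hZ) fun x => ?_
  set f : Finset Λ → ℝ := fun S => Real.exp (κ' * S.card) * ‖A S‖ with hf
  set g : Finset Λ → ℝ := fun S => Real.exp (κ' * S.card) * ‖Z S‖ with hg
  have hf0 : ∀ S, 0 ≤ f S := fun S => by positivity
  have hg0 : ∀ S, 0 ≤ g S := fun S => by positivity
  have hbd : ∀ {Y : Finset Λ → Op q Λ}, IsPotential Y →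
      (∑ S, if x ∈ S then (S.card : ℝ) * (Real.exp (κ' * S.card) * ‖Y S‖) else 0) ≤
        1 / (Real.exp 1 * (κ - κ')) * potNorm κ Y := by
    intro Y hY
    have hd : 0 < κ - κ' := sub_pos.2 h
    refine le_trans ?_ (mul_le_mul_of_nonneg_left (siteSum_le hY κ x) (by positivity))
    rw [siteSum, Finset.mul_sum]
    refine Finset.sum_le_sum fun S _ => ?_
    split_ifs
    · rw [← mul_assoc, ← mul_assoc]
      exact mul_le_mul_of_nonneg_right (mul_exp_le h _) (norm_nonneg _)
    · simp
  have hM : ∀ {Y : Finset Λ → Op q Λ}, IsPotential Y → ∀ y : Λ,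
      ∑ T, (if y ∈ T then Real.exp (κ' * T.card) * ‖Y T‖ else 0) ≤ potNorm κ Y := by
    intro Y hY y
    refine le_trans ?_ (siteSum_le hY κ y)
    exact siteSum_mono h.le y fun _ => le_rfl
  have step1 : siteSum κ' x (comm A Z) ≤ ∑ S, ∑ T,
      2 * Real.exp (-κ') * ((if x ∈ S ∧ ¬ Disjoint S T then f S * g T else 0) +
        (if x ∈ T ∧ ¬ Disjoint T S then g T * f S else 0)) := by
    have e1 : siteSum κ' x (comm A Z) ≤ ∑ P, ∑ S, ∑ T,
        if S ∪ T = P then (if x ∈ S ∪ T ∧ ¬ Disjoint S T then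
          2 * Real.exp (-κ') * (f S * g T) else 0) else 0 := by
      refine Finset.sum_le_sum fun P _ => ?_
      split_ifs with hx
      · calc Real.exp (κ' * P.card) * ‖comm A Z P‖
            ≤ Real.exp (κ' * P.card) * ∑ S, ∑ T, ‖if S ∪ T = P ∧ ¬ Disjoint S T then
                A S * Z T - Z T * A S else 0‖ := by
              gcongr
              exact (norm_sum_le _ _).trans (Finset.sum_le_sum fun S _ => norm_sum_le _ _)
          _ = ∑ S, ∑ T, Real.exp (κ' * P.card) * ‖if S ∪ T = P ∧ ¬ Disjoint S T then
                A S * Z T - Z T * A S else 0‖ := by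
              simp_rw [Finset.mul_sum]
          _ ≤ _ := by
              refine Finset.sum_le_sum fun S _ => Finset.sum_le_sum fun T _ => ?_
              by_cases hP : S ∪ T = P
              · subst hP
                by_cases hd : Disjoint S T
                · simp [hd]
                · simp only [hd, not_false_eq_true, and_true, if_true, hx]
                  have hc : ((S ∪ T).card : ℝ) ≤ S.card + T.card - 1 := by
                    have h1 := Finset.card_union_add_card_inter S T
                    have h2 : 1 ≤ (S ∩ T).card := by
                      rw [Nat.one_le_iff_ne_zero, Finset.card_ne_zero,
                        Finset.nonempty_iff_ne_empty]
                      exact fun h' => hd (Finset.disjoint_iff_inter_eq_empty.2 h')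
                    have h3 : (S ∪ T).card + 1 ≤ S.card + T.card := by omega
                    have h4 : ((S ∪ T).card : ℝ) + 1 ≤ S.card + T.card := by exact_mod_cast h3
                    linarith
                  have hn : ‖A S * Z T - Z T * A S‖ ≤ 2 * (‖A S‖ * ‖Z T‖) := by
                    refine (norm_sub_le _ _).trans ?_
                    have := norm_mul_le (A S) (Z T)
                    have := norm_mul_le (Z T) (A S)
                    linarith
                  have he : Real.exp (κ' * (S ∪ T).card) ≤
                      Real.exp (-κ') * (Real.exp (κ' * S.card) * Real.exp (κ' * T.card)) := by
                    rw [← Real.exp_add, ← Real.exp_add]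
                    refine Real.exp_le_exp.2 ?_
                    have := mul_le_mul_of_nonneg_left hc hκ'
                    linarith
                  calc _ ≤ (Real.exp (-κ') * (Real.exp (κ' * S.card) * Real.exp (κ' * T.card))) *
                        (2 * (‖A S‖ * ‖Z T‖)) := by gcongr
                    _ = _ := by simp only [hf, hg]; ring
              · simp [hP]
      · refine Finset.sum_nonneg fun S _ => Finset.sum_nonneg fun T _ => ?_
        have := mul_nonneg (hf0 S) (hg0 T)
        split_ifs <;> positivity
    refine e1.trans ?_
    rw [Finset.sum_comm]
    refine Finset.sum_le_sum fun S _ => ?_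
    rw [Finset.sum_comm]
    refine Finset.sum_le_sum fun T _ => ?_
    rw [Finset.sum_ite_eq, if_pos (Finset.mem_univ _)]
    have hpos := mul_nonneg (hf0 S) (hg0 T)
    have hpos' := mul_nonneg (hg0 T) (hf0 S)
    by_cases hd : Disjoint S T
    · simp [hd, hd.symm]
    · have hd' : ¬ Disjoint T S := fun h => hd h.symm
      simp only [hd, hd', not_false_eq_true, and_true, Finset.mem_union]
      by_cases hS : x ∈ S
      · simp only [hS, true_or, if_true]
        gcongr
        split_ifs <;> linarith
      · by_cases hT : x ∈ T
        · simp [hS, hT, mul_comm]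
        · simp [hS, hT]
  refine step1.trans ?_
  simp_rw [← Finset.mul_sum, Finset.sum_add_distrib]
  have k1 := sum_overlap_le hf0 hg0 (fun S => x ∈ S) (hM hZ)
  have k2 := sum_overlap_le hg0 hf0 (fun S => x ∈ S) (hM hA)
  rw [Finset.sum_comm] at k2
  have j1 := mul_le_mul_of_nonneg_right (hbd hA) (potNorm_nonneg κ Z)
  have j2 := mul_le_mul_of_nonneg_right (hbd hZ) (potNorm_nonneg κ A)
  have := add_le_add (k1.trans j1) (k2.trans j2)
  calc _ ≤ 2 * Real.exp (-κ') * (1 / (Real.exp 1 * (κ - κ')) * potNorm κ A * potNorm κ Z +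
        1 / (Real.exp 1 * (κ - κ')) * potNorm κ Z * potNorm κ A) := by gcongr
    _ = _ := by ring

attribute [local irreducible] potNorm siteSum

/-! ### Lie series -/

section LieSeries

variable {𝔸 : Type*} [NormedRing 𝔸] [NormedAlgebra ℂ 𝔸]

/-- The commutator with `a`, as a continuous linear map. -/
noncomputable def adCLM (a : 𝔸) : 𝔸 →L[ℂ] 𝔸 :=
  ContinuousLinearMap.mul ℂ 𝔸 a + (ContinuousLinearMap.mul ℂ 𝔸).flip (-a)

theorem adCLM_apply (a z : 𝔸) : adCLM a z = a * z - z * a := by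
  simp [adCLM, sub_eq_add_neg]

theorem hasSum_exp_clm {E : Type*} [NormedAddCommGroup E] [NormedSpace ℂ E] [CompleteSpace E]
    (B : E →L[ℂ] E) (z : E) :
    HasSum (fun m : ℕ => ((m.factorial : ℂ)⁻¹) • (B ^ m) z) (NormedSpace.exp B z) := by
  have h := NormedSpace.exp_series_hasSum_exp' (𝕂 := ℂ) B
  have h2 := h.mapL (ContinuousLinearMap.apply ℂ E z)
  simpa only [ContinuousLinearMap.apply_apply, smul_apply] using h2

variable [CompleteSpace 𝔸]

theorem exp_mul_left_apply (a z : 𝔸) :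
    NormedSpace.exp (ContinuousLinearMap.mul ℂ 𝔸 a) z = NormedSpace.exp a * z := by
  have h1 := hasSum_exp_clm (ContinuousLinearMap.mul ℂ 𝔸 a) z
  have h2 := (NormedSpace.exp_series_hasSum_exp' (𝕂 := ℂ) a).mul_right z
  refine h1.unique (h2.congr_fun fun m => ?_)
  rw [smul_mul_assoc]
  congr 1
  induction m with
  | zero => simp
  | succ m ih => rw [pow_succ', pow_succ', mul_apply_eq_comp, ih]; simp [mul_assoc]

theorem exp_mul_right_apply (a z : 𝔸) :
    NormedSpace.exp ((ContinuousLinearMap.mul ℂ 𝔸).flip a) z = z * NormedSpace.exp a := by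
  have h1 := hasSum_exp_clm ((ContinuousLinearMap.mul ℂ 𝔸).flip a) z
  have h2 := (NormedSpace.exp_series_hasSum_exp' (𝕂 := ℂ) a).mul_left z
  refine h1.unique (h2.congr_fun fun m => ?_)
  rw [mul_smul_comm]
  congr 1
  induction m with
  | zero => simp
  | succ m ih => rw [pow_succ', pow_succ, mul_apply_eq_comp, ih]; simp [mul_assoc]

/-- Left and right multiplication by `a` commute, so the exponential of their difference factorizes
into conjugation by `e^a`. -/
theorem hasSum_conj (a z : 𝔸) :
    HasSum (fun m : ℕ => ((m.factorial : ℂ)⁻¹) • (adCLM a ^ m) z)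
      (NormedSpace.exp a * z * NormedSpace.exp (-a)) := by
  have h := hasSum_exp_clm (adCLM a) z
  let _ : NormedAlgebra ℚ (𝔸 →L[ℂ] 𝔸) := NormedAlgebra.restrictScalars ℚ ℂ _
  have hc : Commute (ContinuousLinearMap.mul ℂ 𝔸 a)
      ((ContinuousLinearMap.mul ℂ 𝔸).flip (-a)) := by
    ext1 y
    simp [mul_assoc]
  have he : NormedSpace.exp (adCLM a) z = NormedSpace.exp a * z * NormedSpace.exp (-a) := by
    rw [adCLM, NormedSpace.exp_add_of_commute hc, mul_apply_eq_comp,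
      exp_mul_right_apply, exp_mul_left_apply, ← mul_assoc]
  rwa [he] at h

/-- The Lie series of `e^a (n + D + V) e^{-a}` when `[a, n] = -V`. -/
theorem hasSum_conj_of_comm {a n D V : 𝔸} (h : a * n - n * a = -V) :
    HasSum (fun m : ℕ => (((m + 1).factorial : ℂ)⁻¹) • (adCLM a ^ (m + 1)) D +
        (((m + 1).factorial : ℂ)⁻¹ - ((m + 2).factorial : ℂ)⁻¹) • (adCLM a ^ (m + 1)) V)
      (NormedSpace.exp a * (n + (D + V)) * NormedSpace.exp (-a) - n - D) := by
  -- The series for `n` is shifted by one more than those for `D` and `V`: its term of order `m + 2`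
  -- is minus `ad^{m+1} V`, which gives the difference of inverse factorials, and its first-order
  -- term cancels `V`.
  have hD := (hasSum_nat_add_iff' 1).2 (hasSum_conj a D)
  have hV := (hasSum_nat_add_iff' 1).2 (hasSum_conj a V)
  have hn := (hasSum_nat_add_iff' 2).2 (hasSum_conj a n)
  have e := (hD.add hV).add hn
  have e1 : adCLM a n = -V := by rw [adCLM_apply, h]
  have e2 : NormedSpace.exp a * (n + (D + V)) * NormedSpace.exp (-a) - n - D =
      NormedSpace.exp a * D * NormedSpace.exp (-a) -
          ∑ i ∈ Finset.range 1, ((i.factorial : ℂ)⁻¹) • (adCLM a ^ i) D +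
        (NormedSpace.exp a * V * NormedSpace.exp (-a) -
          ∑ i ∈ Finset.range 1, ((i.factorial : ℂ)⁻¹) • (adCLM a ^ i) V) +
      (NormedSpace.exp a * n * NormedSpace.exp (-a) -
          ∑ i ∈ Finset.range 2, ((i.factorial : ℂ)⁻¹) • (adCLM a ^ i) n) := by
    simp only [Finset.sum_range_succ, Finset.sum_range_zero, pow_zero, pow_one, e1]
    simp only [Nat.factorial, Nat.cast_one, inv_one, one_smul, one_apply_eq_self,
      mul_one, zero_add, mul_add, add_mul]
    abel
  rw [e2]
  refine e.congr_fun fun m => ?_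
  have : (adCLM a ^ (m + 2)) n = -(adCLM a ^ (m + 1)) V := by
    rw [pow_succ, mul_apply_eq_comp, e1, map_neg]
  rw [this, sub_smul, smul_neg]
  abel

end LieSeries

/-! ### Lie series of potentials -/

/-- `comm A` as a continuous linear map. -/
noncomputable def commCLM (A : Finset Λ → Op q Λ) :
    (Finset Λ → Op q Λ) →L[ℂ] (Finset Λ → Op q Λ) :=
  LinearMap.toContinuousLinearMap
    { toFun := comm A
      map_add' := fun Y Z => by
        classical
        funext P
        simp only [comm, Pi.add_apply, ← Finset.sum_add_distrib]
        refine Finset.sum_congr rfl fun S _ => Finset.sum_congr rfl fun T _ => ?_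
        split_ifs
        · rw [mul_add, add_mul]; abel
        · simp
      map_smul' := fun c Z => by
        classical
        funext P
        simp only [comm, Pi.smul_apply, Finset.smul_sum, RingHom.id_apply]
        refine Finset.sum_congr rfl fun S _ => Finset.sum_congr rfl fun T _ => ?_
        split_ifs
        · rw [mul_smul_comm, smul_mul_assoc, smul_sub]
        · simp }

theorem commCLM_apply (A Z : Finset Λ → Op q Λ) : commCLM A Z = comm A Z := rfl

theorem IsPotential.add {Y Z : Finset Λ → Op q Λ} (hY : IsPotential Y) (hZ : IsPotential Z) :
    IsPotential (Y + Z) where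
  actsWithin S := add_mem (S := Subalgebra ℂ (Op q Λ)) (mem_localAlg.2 (hY.actsWithin S))
    (mem_localAlg.2 (hZ.actsWithin S))
  eq_zero S hS := by simp [hY.eq_zero S hS, hZ.eq_zero S hS]

theorem IsPotential.smul {Z : Finset Λ → Op q Λ} (hZ : IsPotential Z) (c : ℂ) :
    IsPotential (c • Z) where
  actsWithin S := (localAlg q S).smul_mem (mem_localAlg.2 (hZ.actsWithin S)) c
  eq_zero S hS := by simp [hZ.eq_zero S hS]

theorem IsPotential.neg {Z : Finset Λ → Op q Λ} (hZ : IsPotential Z) : IsPotential (-Z) := by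
  simpa using hZ.smul (-1)

theorem IsPotential.sub {Y Z : Finset Λ → Op q Λ} (hY : IsPotential Y) (hZ : IsPotential Z) :
    IsPotential (Y - Z) := by
  simpa [sub_eq_add_neg] using hY.add hZ.neg

theorem isPotential_hasSum {f : ℕ → Finset Λ → Op q Λ} {Z : Finset Λ → Op q Λ}
    (hf : ∀ m, IsPotential (f m)) (h : HasSum f Z) : IsPotential Z where
  actsWithin S := by
    rw [← mem_localAlg]
    have h1 := (Pi.hasSum.1 h S).tendsto_sum_nat
    exact (isClosed_localAlg S).mem_of_tendsto h1
      (Filter.Eventually.of_forall fun n => sum_mem fun m _ => (hf m).actsWithin S)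
  eq_zero S hS := by
    have h1 := Pi.hasSum.1 h S
    simp only [(hf _).eq_zero S hS] at h1
    exact h1.unique hasSum_zero

theorem isPotential_commCLM_pow {A Z : Finset Λ → Op q Λ} (hA : IsPotential A)
    (hZ : IsPotential Z) (m : ℕ) : IsPotential ((commCLM A ^ m) Z) := by
  induction m with
  | zero => simpa using hZ
  | succ m ih =>
    rw [pow_succ', mul_apply_eq_comp, commCLM_apply]
    exact isPotential_comm hA ih

theorem total_commCLM_pow {A Z : Finset Λ → Op q Λ} (hA : IsPotential A)
    (hZ : IsPotential Z) (m : ℕ) : total ((commCLM A ^ m) Z) = (adCLM (total A) ^ m) (total Z) := by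
  induction m with
  | zero => simp
  | succ m ih =>
    rw [pow_succ', pow_succ', mul_apply_eq_comp, mul_apply_eq_comp, ← ih,
      commCLM_apply, adCLM_apply, total_comm hA (isPotential_commCLM_pow hA hZ m)]

/-- The potential of `e^A (n + D + V) e^{-A} - n - D` when `[A, n] = -V`. -/
noncomputable def remainder (A D V : Finset Λ → Op q Λ) : Finset Λ → Op q Λ :=
  ∑' m : ℕ, ((((m + 1).factorial : ℂ)⁻¹) • (commCLM A ^ (m + 1)) D +
        (((m + 1).factorial : ℂ)⁻¹ - ((m + 2).factorial : ℂ)⁻¹) • (commCLM A ^ (m + 1)) V)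

theorem norm_factorial_sub_le (m : ℕ) :
    ‖((m + 1).factorial : ℂ)⁻¹ - ((m + 2).factorial : ℂ)⁻¹‖ ≤ ((m + 1).factorial : ℝ)⁻¹ := by
  have h : ((m + 1).factorial : ℂ)⁻¹ - ((m + 2).factorial : ℂ)⁻¹
      = (((m + 1).factorial : ℝ)⁻¹ - ((m + 2).factorial : ℝ)⁻¹ : ℝ) := by push_cast; rfl
  rw [h, Complex.norm_real, Real.norm_eq_abs, abs_of_nonneg]
  · have : (0 : ℝ) ≤ ((m + 2).factorial : ℝ)⁻¹ := by positivity
    linarith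
  · rw [sub_nonneg]
    gcongr
    omega

/-- Convergence uses only finite dimension, with an operator norm of `commCLM A` that may depend on
the volume. The uniform bound is obtained separately in `potNorm_remainder_le`. -/
theorem hasSum_remainder (A D V : Finset Λ → Op q Λ) :
    HasSum (fun m : ℕ => (((m + 1).factorial : ℂ)⁻¹) • (commCLM A ^ (m + 1)) D +
        (((m + 1).factorial : ℂ)⁻¹ - ((m + 2).factorial : ℂ)⁻¹) • (commCLM A ^ (m + 1)) V)
      (remainder A D V) := by
  refine Summable.hasSum ?_
  have hs : Summable fun m : ℕ => ‖commCLM A‖ ^ (m + 1) / (m + 1).factorial * (‖D‖ + ‖V‖) :=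
    ((summable_nat_add_iff 1).2 (Real.summable_pow_div_factorial ‖commCLM A‖)).mul_right _
  refine Summable.of_norm_bounded hs fun m => ?_
  have hb : ∀ Z, ‖(commCLM A ^ (m + 1)) Z‖ ≤ ‖commCLM A‖ ^ (m + 1) * ‖Z‖ := fun Z =>
    (ContinuousLinearMap.le_opNorm _ _).trans
      (mul_le_mul_of_nonneg_right (norm_pow_le' _ (Nat.succ_pos m)) (norm_nonneg _))
  calc _ ≤ ((m + 1).factorial : ℝ)⁻¹ * (‖commCLM A‖ ^ (m + 1) * ‖D‖) +
        ((m + 1).factorial : ℝ)⁻¹ * (‖commCLM A‖ ^ (m + 1) * ‖V‖) := by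
        refine (norm_add_le _ _).trans (add_le_add ?_ ?_)
        · rw [norm_smul, norm_inv, Complex.norm_natCast]
          gcongr
          exact hb D
        · rw [norm_smul]
          exact mul_le_mul (norm_factorial_sub_le m) (hb V) (norm_nonneg _) (by positivity)
    _ = _ := by ring

theorem isPotential_remainder {A D V : Finset Λ → Op q Λ} (hA : IsPotential A)
    (hD : IsPotential D) (hV : IsPotential V) : IsPotential (remainder A D V) :=
  isPotential_hasSum (fun _ => ((isPotential_commCLM_pow hA hD _).smul _).add
    ((isPotential_commCLM_pow hA hV _).smul _)) (hasSum_remainder A D V)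

theorem total_add (Y Z : Finset Λ → Op q Λ) : total (Y + Z) = total Y + total Z := by
  simp [total, Finset.sum_add_distrib]

theorem total_smul (c : ℂ) (Z : Finset Λ → Op q Λ) : total (c • Z) = c • total Z := by
  simp [total, Finset.smul_sum]

theorem total_sub (Y Z : Finset Λ → Op q Λ) : total (Y - Z) = total Y - total Z := by
  simp [total]

theorem total_hasSum {f : ℕ → Finset Λ → Op q Λ} {Z : Finset Λ → Op q Λ}
    (h : HasSum f Z) : HasSum (fun m : ℕ => total (f m)) (total Z) :=
  hasSum_sum fun S _ => Pi.hasSum.1 h S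

theorem total_remainder {A D V : Finset Λ → Op q Λ} (hA : IsPotential A)
    (hD : IsPotential D) (hV : IsPotential V) {n : Op q Λ}
    (h : total A * n - n * total A = -total V) :
    total (remainder A D V) = NormedSpace.exp (total A) * (n + (total D + total V)) *
      NormedSpace.exp (-total A) - n - total D := by
  refine (total_hasSum (hasSum_remainder A D V)).unique ?_
  refine (hasSum_conj_of_comm h).congr_fun fun m => ?_
  rw [total_add, total_smul, total_smul, total_commCLM_pow hA hD, total_commCLM_pow hA hV]

theorem potNorm_commCLM_pow_le [Nonempty Λ] {κ κ' : ℝ} (h : κ' < κ) (hκ' : 0 ≤ κ')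
    {A Z : Finset Λ → Op q Λ} (hA : IsPotential A) (hZ : IsPotential Z) (m : ℕ) :
    ((m + 1).factorial : ℝ)⁻¹ * potNorm κ' ((commCLM A ^ (m + 1)) Z) ≤
      (4 / (κ - κ') * potNorm κ A) ^ (m + 1) * (Real.exp (-κ') * potNorm κ Z) := by
  have hd : 0 < κ - κ' := sub_pos.2 h
  have hm : (0 : ℝ) < m + 1 := by positivity
  -- The total loss `κ - κ'` is split equally over the `m + 1` commutators.
  set δ := (κ - κ') / (m + 1) with hδ
  have hδ0 : 0 < δ := by positivity
  have hδm : (m + 1) * δ = κ - κ' := by rw [hδ]; field_simp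
  set c := 4 / (Real.exp 1 * δ) * Real.exp (-κ') * potNorm κ A with hc
  have hA0 := potNorm_nonneg κ A
  have hZ0 := potNorm_nonneg κ Z
  have hc0 : 0 ≤ c := by positivity
  have key : ∀ j : ℕ, j ≤ m + 1 →
      potNorm (κ - j * δ) ((commCLM A ^ j) Z) ≤ c ^ j * potNorm κ Z := by
    intro j
    induction j with
    | zero => simp
    | succ j ih =>
      intro hj
      have hj' : (j : ℝ) + 1 ≤ m + 1 := by exact_mod_cast hj
      have hlow : κ' ≤ κ - (j + 1 : ℕ) * δ := by
        push_cast
        nlinarith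
      rw [pow_succ', mul_apply_eq_comp, commCLM_apply]
      refine (potNorm_comm_le (κ := κ - j * δ) (by push_cast; linarith) (hκ'.trans hlow) hA
        (isPotential_commCLM_pow hA hZ j)).trans ?_
      have e1 : κ - j * δ - (κ - (j + 1 : ℕ) * δ) = δ := by push_cast; ring
      have e2 : potNorm (κ - j * δ) A ≤ potNorm κ A := by
        have := potNorm_mono (κ := κ) (κ' := κ - j * δ) (c := 1)
          (by have : 0 ≤ j * δ := by positivity
              linarith) hA hA zero_le_one (by simp)
        simpa using this
      have e3 := ih (by omega)
      have e4 := potNorm_nonneg (κ - j * δ) A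
      have e5 := potNorm_nonneg (κ - j * δ) ((commCLM A ^ j) Z)
      rw [e1]
      calc _ ≤ 4 / (Real.exp 1 * δ) * Real.exp (-κ') * potNorm κ A * (c ^ j * potNorm κ Z) := by
            gcongr
        _ = _ := by rw [pow_succ, hc]; ring
  have k := key (m + 1) le_rfl
  have e0 : κ - (m + 1 : ℕ) * δ = κ' := by push_cast; linarith
  rw [e0] at k
  -- The powers of `m + 1` caused by the splitting are cancelled by the factorial, and the factors
  -- `e` by those in `potNorm_comm_le`.
  have hfac : ((m + 1).factorial : ℝ)⁻¹ * ((m : ℝ) + 1) ^ (m + 1) ≤ Real.exp 1 ^ (m + 1) := by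
    have := Real.pow_div_factorial_le_exp ((m : ℝ) + 1) (by positivity) (m + 1)
    rw [← Real.exp_nat_mul]
    push_cast
    rw [mul_one]
    refine le_trans (le_of_eq ?_) this
    rw [div_eq_inv_mul]
  have hc' : c = (4 / (κ - κ') * potNorm κ A) * ((m + 1) / Real.exp 1 * Real.exp (-κ')) := by
    rw [hc, hδ]; field_simp
  -- Only one of the gains `e^{-κ'}` is kept; it later becomes `1/κ'` and accounts for the second
  -- power of `1/κ₀` in `ν₀`.
  have hle : Real.exp (-κ') ^ (m + 1) ≤ Real.exp (-κ') := by
    refine (pow_le_of_le_one (Real.exp_pos _).le ?_ (Nat.succ_ne_zero m))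
    rw [Real.exp_le_one_iff]; linarith
  calc _ ≤ ((m + 1).factorial : ℝ)⁻¹ * (c ^ (m + 1) * potNorm κ Z) := by gcongr
    _ = (4 / (κ - κ') * potNorm κ A) ^ (m + 1) * (Real.exp (-κ') ^ (m + 1) * potNorm κ Z) *
        ((((m + 1).factorial : ℝ)⁻¹ * ((m : ℝ) + 1) ^ (m + 1)) / Real.exp 1 ^ (m + 1)) := by
        rw [hc', mul_pow (4 / (κ - κ') * potNorm κ A), mul_pow (_ / _) (Real.exp _), div_pow]; ring
    _ ≤ (4 / (κ - κ') * potNorm κ A) ^ (m + 1) * (Real.exp (-κ') * potNorm κ Z) * 1 := by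
        gcongr
        rw [div_le_one (by positivity)]
        exact hfac
    _ = _ := mul_one _

theorem siteSum_zero (κ : ℝ) (x : Λ) : siteSum κ x (0 : Finset Λ → Op q Λ) = 0 := by
  simpa using siteSum_smul κ x 0 (0 : Finset Λ → Op q Λ)

/-- Termwise bounds pass to the sum because each `siteSum` is subadditive and continuous. -/
theorem potNorm_hasSum_le [Nonempty Λ] {κ : ℝ} {f : ℕ → Finset Λ → Op q Λ}
    {Z : Finset Λ → Op q Λ} (hZ : IsPotential Z) (h : HasSum f Z) {b : ℕ → ℝ} {c : ℝ}
    (hb : ∀ m x, siteSum κ x (f m) ≤ b m) (hb0 : ∀ m, 0 ≤ b m) (hc : HasSum b c) :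
    potNorm κ Z ≤ c := by
  refine potNorm_le hZ fun x => ?_
  have ht := ((continuous_siteSum κ x).tendsto Z).comp h.tendsto_sum_nat
  refine le_of_tendsto ht (Filter.Eventually.of_forall fun n => ?_)
  refine le_trans ?_ (sum_le_hasSum (Finset.range n) (fun m _ => hb0 m) hc)
  simp only [Function.comp]
  induction n with
  | zero => simp [siteSum_zero]
  | succ n ih =>
    rw [Finset.sum_range_succ, Finset.sum_range_succ]
    exact (siteSum_add_le κ x _ _).trans (add_le_add ih (hb n x))

theorem potNorm_remainder_le [Nonempty Λ] {κ κ' : ℝ} (h : κ' < κ) (hκ' : 0 ≤ κ')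
    {A D V : Finset Λ → Op q Λ} (hA : IsPotential A) (hD : IsPotential D) (hV : IsPotential V)
    (hsmall : 6 * potNorm κ A ≤ κ - κ') :
    potNorm κ' (remainder A D V) ≤
      12 / (κ - κ') * Real.exp (-κ') * potNorm κ A * (potNorm κ D + potNorm κ V) := by
  have hd : 0 < κ - κ' := sub_pos.2 h
  have hA0 := potNorm_nonneg κ A
  have hD0 := potNorm_nonneg κ D
  have hV0 := potNorm_nonneg κ V
  set r := 4 / (κ - κ') * potNorm κ A with hr
  have hr0 : 0 ≤ r := by positivity
  -- With ratio at most `2/3` the geometric series costs a factor 3, whence `12 = 3 · 4`.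
  have hr1 : r ≤ 2 / 3 := by
    rw [hr, div_mul_eq_mul_div, div_le_iff₀ hd]; linarith
  have hsum : HasSum (fun m : ℕ => r ^ (m + 1) *
      (Real.exp (-κ') * (potNorm κ D + potNorm κ V)))
      ((1 - r)⁻¹ * (r * (Real.exp (-κ') * (potNorm κ D + potNorm κ V)))) := by
    have := (hasSum_geometric_of_lt_one hr0 (by linarith)).mul_right
      (r * (Real.exp (-κ') * (potNorm κ D + potNorm κ V)))
    refine this.congr_fun fun m => ?_
    ring
  refine (potNorm_hasSum_le (isPotential_remainder hA hD hV) (hasSum_remainder A D V)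
    (fun m x => ?_) (fun _ => by positivity) hsum).trans ?_
  · refine (siteSum_add_le κ' x _ _).trans ?_
    rw [siteSum_smul, siteSum_smul, norm_inv, Complex.norm_natCast, mul_add, mul_add]
    refine add_le_add ?_ ?_
    · refine le_trans ?_ (potNorm_commCLM_pow_le h hκ' hA hD m)
      gcongr
      exact siteSum_le (isPotential_commCLM_pow hA hD _) _ _
    · refine le_trans ?_ (potNorm_commCLM_pow_le h hκ' hA hV m)
      have := siteSum_nonneg κ' x ((commCLM A ^ (m + 1)) V)
      exact mul_le_mul (norm_factorial_sub_le m)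
        (siteSum_le (isPotential_commCLM_pow hA hV _) _ _) this (by positivity)
  · have h3 : (1 - r)⁻¹ ≤ 3 := by
      rw [inv_le_comm₀ (by linarith) (by norm_num)]; linarith
    calc _ ≤ 3 * (r * (Real.exp (-κ') * (potNorm κ D + potNorm κ V))) := by gcongr
      _ = _ := by rw [hr]; ring

/-! ### Rotations generated by a self-adjoint operator -/

section Rotation

open Complex (I)

variable {𝔸 : Type*} [NormedRing 𝔸] [NormedAlgebra ℂ 𝔸] [CompleteSpace 𝔸]

/-- The rotated operator `e^{isN} O e^{-isN}`. -/
noncomputable def rot (N O : 𝔸) (s : ℝ) : 𝔸 :=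
  NormedSpace.exp ((I * (s : ℂ)) • N) * O * NormedSpace.exp ((-(I * (s : ℂ))) • N)

theorem rot_arg (N : 𝔸) (s : ℝ) : (I * (s : ℂ)) • N = s • (I • N) := by
  rw [mul_comm, mul_smul, Complex.coe_smul]

theorem rot_arg_neg (N : 𝔸) (s : ℝ) : (-(I * (s : ℂ))) • N = s • (-(I • N)) := by
  rw [neg_smul, rot_arg, smul_neg]

theorem exp_neg_mul_exp (a : 𝔸) : NormedSpace.exp (-a) * NormedSpace.exp a = 1 := by
  let _ : NormedAlgebra ℚ 𝔸 := NormedAlgebra.restrictScalars ℚ ℂ _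
  rw [← NormedSpace.exp_add_of_commute (Commute.refl a).neg_left, neg_add_cancel,
    NormedSpace.exp_zero]

theorem exp_mul_exp_neg (a : 𝔸) : NormedSpace.exp a * NormedSpace.exp (-a) = 1 := by
  simpa using exp_neg_mul_exp (-a)

theorem rot_zero (N O : 𝔸) : rot N O 0 = O := by
  simp [rot]

theorem hasDerivAt_rot (N O : 𝔸) (s : ℝ) :
    HasDerivAt (rot N O) (I • adCLM N (rot N O s)) s := by
  have h1 := hasDerivAt_exp_smul_const' (𝕂 := ℝ) (I • N) s
  have h2 := hasDerivAt_exp_smul_const (𝕂 := ℝ) (-(I • N)) s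
  have h := (h1.mul_const O).mul h2
  have e : rot N O = fun s : ℝ =>
      NormedSpace.exp (s • (I • N)) * O * NormedSpace.exp (s • (-(I • N))) := by
    funext s; rw [rot, rot_arg, rot_arg_neg]
  rw [e]
  refine h.congr_deriv ?_
  rw [adCLM_apply, smul_sub]
  simp only [mul_neg, smul_mul_assoc, mul_smul_comm, mul_assoc, sub_eq_add_neg]

theorem continuous_rot (N O : 𝔸) : Continuous (rot N O) :=
  continuous_iff_continuousAt.2 fun s => (hasDerivAt_rot N O s).continuousAt

/-- The integrand is the derivative of `rot N O (s * ν)` in `s`. This identity drives both the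
average formula and the commutator equation for the generator. -/
theorem adCLM_integral_rot (N O : 𝔸) (ν t : ℝ) :
    (I * (ν : ℂ)) • adCLM N (∫ s in (0 : ℝ)..t, rot N O (s * ν)) = rot N O (t * ν) - O := by
  have hc : Continuous fun s : ℝ => rot N O (s * ν) := (continuous_rot N O).comp (by fun_prop)
  rw [← ContinuousLinearMap.intervalIntegral_comp_comm _ (hc.intervalIntegrable _ _),
    ← intervalIntegral.integral_smul]
  have hd : ∀ s : ℝ, HasDerivAt (fun s : ℝ => rot N O (s * ν))
      ((I * (ν : ℂ)) • adCLM N (rot N O (s * ν))) s := by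
    intro s
    have h := (hasDerivAt_rot N O (s * ν)).scomp s ((hasDerivAt_id s).mul_const ν)
    refine h.congr_deriv ?_
    rw [one_mul, mul_comm I, mul_smul, Complex.coe_smul]
  rw [intervalIntegral.integral_eq_sub_of_hasDerivAt (fun s _ => hd s), zero_mul, rot_zero]
  exact (Continuous.const_smul ((adCLM N).continuous.comp hc) _).intervalIntegrable _ _

theorem rot_sum {ι : Type*} (t : Finset ι) (N : 𝔸) (O : ι → 𝔸) (s : ℝ) :
    rot N (∑ i ∈ t, O i) s = ∑ i ∈ t, rot N (O i) s := by
  simp [rot, Finset.mul_sum, Finset.sum_mul]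

theorem exp_mul_of_eigen {a p : 𝔸} {c : ℂ} (h : a * p = c • p) :
    NormedSpace.exp a * p = Complex.exp c • p := by
  have h1 := (NormedSpace.exp_series_hasSum_exp' (𝕂 := ℂ) a).mul_right p
  have h2 := (NormedSpace.exp_series_hasSum_exp' (𝕂 := ℂ) c).smul_const p
  rw [Complex.exp_eq_exp_ℂ]
  refine h1.unique (h2.congr_fun fun m => ?_)
  rw [smul_mul_assoc, smul_assoc]
  congr 1
  induction m with
  | zero => simp
  | succ m ih => rw [pow_succ, mul_assoc, h, mul_smul_comm, ih, smul_smul, pow_succ, mul_comm]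

theorem mul_exp_of_eigen {a p : 𝔸} {c : ℂ} (h : p * a = c • p) :
    p * NormedSpace.exp a = Complex.exp c • p := by
  have h1 := (NormedSpace.exp_series_hasSum_exp' (𝕂 := ℂ) a).mul_left p
  have h2 := (NormedSpace.exp_series_hasSum_exp' (𝕂 := ℂ) c).smul_const p
  rw [Complex.exp_eq_exp_ℂ]
  refine h1.unique (h2.congr_fun fun m => ?_)
  rw [mul_smul_comm, smul_assoc]
  congr 1
  induction m with
  | zero => simp
  | succ m ih =>
    rw [pow_succ', ← mul_assoc, h, smul_mul_assoc, ih, smul_smul, pow_succ']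

variable [StarRing 𝔸] [CStarRing 𝔸] [StarModule ℂ 𝔸]

theorem exp_mem_unitary {a : 𝔸} (h : star a = -a) : NormedSpace.exp a ∈ unitary 𝔸 := by
  let _ : NormedAlgebra ℚ 𝔸 := NormedAlgebra.restrictScalars ℚ ℂ _
  exact NormedSpace.exp_mem_unitary_of_mem_skewAdjoint (skewAdjoint.mem_iff.2 h)

theorem norm_unitary_conj {u : 𝔸} (hu : u ∈ unitary 𝔸) (a : 𝔸) : ‖u * a * star u‖ = ‖a‖ := by
  have h1 := CStarRing.norm_coe_unitary_mul ⟨u, hu⟩ a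
  have h2 := CStarRing.norm_mul_coe_unitary (u * a) (star ⟨u, hu⟩)
  exact h2.trans h1

theorem star_rot_arg {N : 𝔸} (hN : star N = N) (s : ℝ) :
    star ((I * (s : ℂ)) • N) = -((I * (s : ℂ)) • N) := by
  rw [star_smul, hN, ← neg_smul]
  congr 1
  simp

theorem star_exp_rot_arg {N : 𝔸} (hN : star N = N) (s : ℝ) :
    star (NormedSpace.exp ((I * (s : ℂ)) • N)) = NormedSpace.exp ((-(I * (s : ℂ))) • N) := by
  rw [NormedSpace.star_exp, star_rot_arg hN, neg_smul]

theorem norm_rot {N : 𝔸} (hN : star N = N) (O : 𝔸) (s : ℝ) : ‖rot N O s‖ = ‖O‖ := by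
  rw [rot, ← star_exp_rot_arg hN]
  exact norm_unitary_conj (exp_mem_unitary (star_rot_arg hN s)) O

theorem star_rot {N O : 𝔸} (hN : star N = N) (hO : star O = O) (s : ℝ) :
    star (rot N O s) = rot N O s := by
  rw [rot, ← star_exp_rot_arg hN, star_mul, star_mul, star_star, hO, mul_assoc]

theorem star_integral {f : ℝ → 𝔸} (hf : Continuous f) (a b : ℝ) :
    star (∫ s in a..b, f s) = ∫ s in a..b, star (f s) := by
  have := (((starL' ℝ : 𝔸 ≃L[ℝ] 𝔸) : 𝔸 →L[ℝ] 𝔸)).intervalIntegral_comp_comm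
    (hf.intervalIntegrable (μ := MeasureTheory.volume) a b)
  exact this.symm

/-- The derivative of the rotated operator is `i` times the rotation of `[G, O]`, whose norm does
not depend on time. -/
theorem norm_conj_exp_sub_le {G O : 𝔸} (hG : star G = G) {t : ℝ} (ht : 0 ≤ t) :
    ‖rot G O t - O‖ ≤ t * ‖G * O - O * G‖ := by
  have hd : ∀ s : ℝ, HasDerivAt (rot G O) (I • rot G (adCLM G O) s) s := by
    intro s
    refine (hasDerivAt_rot G O s).congr_deriv ?_
    congr 1
    have c1 : Commute G (NormedSpace.exp ((I * (s : ℂ)) • G)) :=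
      ((Commute.refl G).smul_left _).exp_left.symm
    have c2 : Commute G (NormedSpace.exp ((-(I * (s : ℂ))) • G)) :=
      ((Commute.refl G).smul_left _).exp_left.symm
    rw [adCLM_apply, adCLM_apply, rot, rot, mul_sub, sub_mul]
    congr 1
    · rw [← mul_assoc, ← mul_assoc, c1.eq, mul_assoc, mul_assoc, mul_assoc, mul_assoc]
    · rw [mul_assoc, mul_assoc, ← c2.eq]
      simp only [mul_assoc]
  have := norm_image_sub_le_of_norm_deriv_le_segment' (f := rot G O) (a := 0) (b := t)
    (f' := fun s => I • rot G (adCLM G O) s) (C := ‖G * O - O * G‖)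
    (fun s _ => (hd s).hasDerivWithinAt)
    (fun s _ => by rw [norm_smul, norm_rot hG, adCLM_apply]; simp) t ⟨ht, le_rfl⟩
  rwa [rot_zero, sub_zero, mul_comm] at this

end Rotation

open Complex (I)

/-! ### Averages over a number operator -/

/-- A number operator: self-adjoint with integer spectrum. -/
structure IsNumberOp (N : Op q Λ) : Prop where
  star_eq : star N = N
  exists_int : ∀ z ∈ spectrum ℝ N, ∃ n : ℤ, (n : ℝ) = z

theorem finite_spectrum (N : Op q Λ) : (spectrum ℝ N).Finite :=
  Matrix.finite_real_spectrum

theorem continuousOn_spectrum (f : ℝ → ℝ) (N : Op q Λ) : ContinuousOn f (spectrum ℝ N) :=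
  (finite_spectrum N).continuousOn f

/-- The eigenvalues of a number operator. -/
noncomputable def intSpectrum (N : Op q Λ) : Finset ℤ :=
  ((finite_spectrum N).preimage (f := fun n : ℤ => (n : ℝ)) Int.cast_injective.injOn).toFinset

theorem mem_intSpectrum {N : Op q Λ} {n : ℤ} : n ∈ intSpectrum N ↔ (n : ℝ) ∈ spectrum ℝ N := by
  simp [intSpectrum]

theorem spectralProj_eq_zero {N : Op q Λ} {n : ℤ} (h : n ∉ intSpectrum N) :
    spectralProj N n = 0 := by
  rw [mem_intSpectrum] at h
  rw [spectralProj, cfc_congr (g := fun _ => 0), cfc_const_zero]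
  intro z hz
  simp only [ite_eq_right_iff, one_ne_zero, imp_false]
  rintro rfl
  exact h hz

theorem average_eq_sum (N O : Op q Λ) :
    average N O = ∑ n ∈ intSpectrum N, spectralProj N n * O * spectralProj N n := by
  refine finsum_eq_sum_of_support_subset _ fun n hn => ?_
  by_contra h
  exact hn (by simp [spectralProj_eq_zero h])

theorem IsNumberOp.sum_spectralProj {N : Op q Λ} (hN : IsNumberOp N) :
    ∑ n ∈ intSpectrum N, spectralProj N n = 1 := by
  have hsa : IsSelfAdjoint N := hN.star_eq
  unfold spectralProj
  rw [← cfc_sum _ _ _ (fun n _ => continuousOn_spectrum _ N), ← cfc_one ℝ N]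
  refine cfc_congr fun z hz => ?_
  obtain ⟨n, rfl⟩ := hN.exists_int z hz
  simp only [Finset.sum_apply, Int.cast_inj, Pi.one_apply]
  rw [Finset.sum_ite_eq, if_pos (mem_intSpectrum.2 hz)]

theorem spectralProj_mul_self {N : Op q Λ} (n : ℤ) :
    spectralProj N n * spectralProj N n = spectralProj N n := by
  rw [spectralProj, ← cfc_mul _ _ _ (continuousOn_spectrum _ N) (continuousOn_spectrum _ N)]
  congr 1
  funext z
  simp

theorem IsNumberOp.mul_spectralProj {N : Op q Λ} (hN : IsNumberOp N) (n : ℤ) :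
    N * spectralProj N n = (n : ℂ) • spectralProj N n := by
  have hsa : IsSelfAdjoint N := hN.star_eq
  have h1 : N * spectralProj N n = cfc (fun z : ℝ => z * if z = (n : ℝ) then (1 : ℝ) else 0) N := by
    rw [cfc_mul _ _ _ (continuousOn_spectrum _ N) (continuousOn_spectrum _ N), cfc_id' ℝ N,
      spectralProj]
  have h2 : (n : ℂ) • spectralProj N n =
      cfc (fun z : ℝ => (n : ℝ) * if z = (n : ℝ) then (1 : ℝ) else 0) N := by
    rw [cfc_const_mul _ _ _ (continuousOn_spectrum _ N), spectralProj, ← Complex.coe_smul]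
    simp
  rw [h1, h2]
  refine congrArg (fun f => cfc f N) (funext fun z => ?_)
  by_cases h : z = n <;> simp [h]

theorem commute_spectralProj {N O : Op q Λ} (h : Commute N O) (n : ℤ) :
    Commute (spectralProj N n) O :=
  h.cfc_real _

theorem star_spectralProj (N : Op q Λ) (n : ℤ) : star (spectralProj N n) = spectralProj N n :=
  (cfc_predicate (fun z : ℝ => if z = (n : ℝ) then (1 : ℝ) else 0) N : IsSelfAdjoint _)

theorem star_average {O : Op q Λ} (N : Op q Λ) (hO : star O = O) :
    star (average N O) = average N O := by
  rw [average_eq_sum, star_sum]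
  refine Finset.sum_congr rfl fun n _ => ?_
  rw [star_mul, star_mul, star_spectralProj, hO, mul_assoc]

/-- The average as a continuous linear map. -/
noncomputable def averageCLM (N : Op q Λ) : Op q Λ →L[ℂ] Op q Λ :=
  ∑ n ∈ intSpectrum N, (ContinuousLinearMap.mul ℂ (Op q Λ) (spectralProj N n)).comp
    ((ContinuousLinearMap.mul ℂ (Op q Λ)).flip (spectralProj N n))

theorem averageCLM_apply (N O : Op q Λ) : averageCLM N O = average N O := by
  rw [average_eq_sum, averageCLM, sum_apply]
  refine Finset.sum_congr rfl fun n _ => ?_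
  simp [mul_assoc]

theorem average_sum {ι : Type*} (s : Finset ι) (N : Op q Λ) (O : ι → Op q Λ) :
    average N (∑ i ∈ s, O i) = ∑ i ∈ s, average N (O i) := by
  simp only [← averageCLM_apply, map_sum]

theorem average_zero (N : Op q Λ) : average N 0 = 0 := by
  rw [← averageCLM_apply, map_zero]

theorem average_add (N O O' : Op q Λ) : average N (O + O') = average N O + average N O' := by
  simp only [← averageCLM_apply, map_add]

theorem average_sub (N O O' : Op q Λ) : average N (O - O') = average N O - average N O' := by
  simp only [← averageCLM_apply, map_sub]

namespace IsNumberOp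

variable {N : Op q Λ}

theorem average_of_commute (hN : IsNumberOp N) {O : Op q Λ} (h : Commute N O) :
    average N O = O := by
  rw [average_eq_sum]
  calc _ = ∑ n ∈ intSpectrum N, spectralProj N n * O := by
        refine Finset.sum_congr rfl fun n _ => ?_
        rw [mul_assoc, ← (commute_spectralProj h n).eq, ← mul_assoc, spectralProj_mul_self]
    _ = O := by rw [← Finset.sum_mul, hN.sum_spectralProj, one_mul]

theorem spectralProj_mul (hN : IsNumberOp N) (n : ℤ) :
    spectralProj N n * N = (n : ℂ) • spectralProj N n := by
  rw [(commute_spectralProj (Commute.refl N) n).eq, hN.mul_spectralProj]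

theorem commute_average (hN : IsNumberOp N) (O : Op q Λ) : Commute N (average N O) := by
  rw [average_eq_sum]
  refine Commute.sum_right _ _ _ fun n _ => ?_
  change N * (spectralProj N n * O * spectralProj N n) =
    spectralProj N n * O * spectralProj N n * N
  rw [← mul_assoc, ← mul_assoc, hN.mul_spectralProj, mul_assoc (spectralProj N n * O),
    hN.spectralProj_mul, mul_smul_comm, smul_mul_assoc, smul_mul_assoc]

theorem average_average (hN : IsNumberOp N) (O : Op q Λ) :
    average N (average N O) = average N O :=
  hN.average_of_commute (hN.commute_average O)

theorem average_rot (hN : IsNumberOp N) (O : Op q Λ) (s : ℝ) :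
    average N (rot N O s) = average N O := by
  rw [average_eq_sum, average_eq_sum]
  refine Finset.sum_congr rfl fun n _ => ?_
  have h1 : spectralProj N n * NormedSpace.exp ((I * (s : ℂ)) • N) =
      Complex.exp ((I * (s : ℂ)) * n) • spectralProj N n :=
    mul_exp_of_eigen (by rw [mul_smul_comm, hN.spectralProj_mul, smul_smul])
  have h2 : NormedSpace.exp ((-(I * (s : ℂ))) • N) * spectralProj N n =
      Complex.exp ((-(I * (s : ℂ))) * n) • spectralProj N n :=
    exp_mul_of_eigen (by rw [smul_mul_assoc, hN.mul_spectralProj, smul_smul])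
  rw [rot, mul_assoc, mul_assoc _ _ (spectralProj N n), h2, ← mul_assoc, ← mul_assoc, h1,
    mul_smul_comm, smul_mul_assoc, smul_mul_assoc, smul_smul, ← Complex.exp_add]
  rw [neg_mul, neg_add_cancel, Complex.exp_zero, one_smul]

theorem exp_two_pi (hN : IsNumberOp N) :
    NormedSpace.exp ((I * ((2 * Real.pi : ℝ) : ℂ)) • N) = 1 := by
  rw [← mul_one (NormedSpace.exp _), ← hN.sum_spectralProj, Finset.mul_sum]
  refine Finset.sum_congr rfl fun n _ => ?_
  have h : NormedSpace.exp ((I * ((2 * Real.pi : ℝ) : ℂ)) • N) * spectralProj N n =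
      Complex.exp ((I * ((2 * Real.pi : ℝ) : ℂ)) * n) • spectralProj N n :=
    exp_mul_of_eigen (by rw [smul_mul_assoc, hN.mul_spectralProj, smul_smul])
  rw [h, Complex.exp_eq_one_iff.2 ⟨n, by push_cast; ring⟩, one_smul]

theorem rot_two_pi (hN : IsNumberOp N) (O : Op q Λ) : rot N O (2 * Real.pi) = O := by
  have h := hN.exp_two_pi
  have h2 := congrArg star h
  rw [star_exp_rot_arg hN.star_eq, star_one] at h2
  rw [rot, h, h2, one_mul, mul_one]

/-- The integral over a full period commutes with `N`, since the boundary terms agree; it is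
therefore its own average, and every rotation of `O` has the same average as `O`. -/
theorem average_eq_integral (hN : IsNumberOp N) (O : Op q Λ) :
    average N O = ((1 / (2 * Real.pi) : ℝ) : ℂ) • ∫ s in (0 : ℝ)..(2 * Real.pi), rot N O s := by
  have hpi := Real.pi_pos
  have hc := continuous_rot N O
  have h1 : Commute N (∫ s in (0 : ℝ)..(2 * Real.pi), rot N O s) := by
    have h := adCLM_integral_rot N O 1 (2 * Real.pi)
    simp only [mul_one, Complex.ofReal_one, hN.rot_two_pi, sub_self, smul_eq_zero,
      Complex.I_ne_zero, false_or, adCLM_apply, sub_eq_zero] at h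
    exact h
  have h2 : average N (∫ s in (0 : ℝ)..(2 * Real.pi), rot N O s) =
      ((2 * Real.pi : ℝ) : ℂ) • average N O := by
    rw [← averageCLM_apply, ← ContinuousLinearMap.intervalIntegral_comp_comm _
      (hc.intervalIntegrable _ _)]
    simp only [averageCLM_apply, hN.average_rot, intervalIntegral.integral_const, sub_zero,
      Complex.coe_smul]
  rw [← hN.average_of_commute h1, h2, smul_smul]
  rw [← Complex.ofReal_mul, one_div_mul_cancel (by positivity), Complex.ofReal_one, one_smul]

theorem norm_average_le (hN : IsNumberOp N) (O : Op q Λ) : ‖average N O‖ ≤ ‖O‖ := by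
  have hpi := Real.pi_pos
  rw [hN.average_eq_integral, norm_smul, Complex.norm_real, Real.norm_eq_abs,
    abs_of_pos (by positivity)]
  have := intervalIntegral.norm_integral_le_of_norm_le_const (a := 0) (b := 2 * Real.pi)
    (f := rot N O) (C := ‖O‖) fun s _ => (norm_rot hN.star_eq O s).le
  rw [sub_zero, abs_of_pos (by positivity)] at this
  calc _ ≤ 1 / (2 * Real.pi) * (‖O‖ * (2 * Real.pi)) := by gcongr
    _ = ‖O‖ := by field_simp

/-! ### The generator -/

theorem continuous_rot_mul (N O : Op q Λ) (ν : ℝ) : Continuous fun s : ℝ => rot N O (s * ν) :=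
  (continuous_rot N O).comp (by fun_prop)

theorem continuous_integral_rot (N O : Op q Λ) (ν : ℝ) :
    Continuous fun t : ℝ => ∫ s in (0 : ℝ)..t, rot N O (s * ν) :=
  intervalIntegral.continuous_primitive
    (fun _ _ => (continuous_rot_mul N O ν).intervalIntegrable _ _) 0

theorem generator_eq (ν : ℝ) (N V : Op q Λ) :
    generator ν N V = (I * ((ν / (2 * Real.pi) : ℝ) : ℂ)) •
      ∫ t in (0 : ℝ)..(2 * Real.pi / ν), ∫ s in (0 : ℝ)..t, rot N V (s * ν) := rfl

theorem generator_sum {ι : Type*} (s : Finset ι) (ν : ℝ) (N : Op q Λ) (V : ι → Op q Λ) :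
    generator ν N (∑ i ∈ s, V i) = ∑ i ∈ s, generator ν N (V i) := by
  simp only [generator_eq, rot_sum]
  rw [← Finset.smul_sum, ← intervalIntegral.integral_finsetSum]
  · congr 2
    funext t
    rw [intervalIntegral.integral_finsetSum]
    exact fun i _ => (continuous_rot_mul N (V i) ν).intervalIntegrable _ _
  · exact fun i _ => (continuous_integral_rot N (V i) ν).intervalIntegrable _ _

/-- The inner integral has commutator `rot N V (tν) - V` with `iνN`; its mean over `t` in one period
is `⟨V⟩ - V`. -/
theorem comm_generator (hN : IsNumberOp N) {ν : ℝ} (hν : 0 < ν) (V : Op q Λ) :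
    ((ν : ℂ) • N) * generator ν N V - generator ν N V * ((ν : ℂ) • N) = average N V - V := by
  have hpi := Real.pi_pos
  have hνc : (ν : ℂ) ≠ 0 := by exact_mod_cast hν.ne'
  have hI := continuous_integral_rot N V ν
  have e1 : ((ν : ℂ) • N) * generator ν N V - generator ν N V * ((ν : ℂ) • N) =
      (ν : ℂ) • adCLM N (generator ν N V) := by
    rw [adCLM_apply, smul_sub, smul_mul_assoc, mul_smul_comm]
  have e2 : (ν : ℂ) • adCLM N (generator ν N V) = ((ν / (2 * Real.pi) : ℝ) : ℂ) •
      ∫ t in (0 : ℝ)..(2 * Real.pi / ν), (rot N V (t * ν) - V) := by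
    rw [generator_eq, map_smul, ← ContinuousLinearMap.intervalIntegral_comp_comm _
      (hI.intervalIntegrable _ _)]
    simp_rw [← adCLM_integral_rot N V ν]
    rw [intervalIntegral.integral_smul, smul_smul, smul_smul]
    congr 1
    ring
  rw [e1, e2, intervalIntegral.integral_sub ((continuous_rot_mul N V ν).intervalIntegrable _ _)
    (intervalIntegrable_const), intervalIntegral.integral_comp_mul_right (rot N V) hν.ne',
    intervalIntegral.integral_const, hN.average_eq_integral, zero_mul, sub_zero,
    div_mul_cancel₀ _ hν.ne', smul_sub, ← Complex.coe_smul, ← Complex.coe_smul, smul_smul,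
    smul_smul, ← Complex.ofReal_mul, ← Complex.ofReal_mul]
  congr 2
  · congr 1
    field_simp
  · rw [show ν / (2 * Real.pi) * (2 * Real.pi / ν) = 1 by field_simp, Complex.ofReal_one, one_smul]

/-- The inner integral is at most `t‖V‖`, and the mean of `t` over a period `2π/ν` is `π/ν`. -/
theorem norm_generator_le (hN : IsNumberOp N) {ν : ℝ} (hν : 0 < ν) (V : Op q Λ) :
    ‖generator ν N V‖ ≤ Real.pi / ν * ‖V‖ := by
  have hpi := Real.pi_pos
  have h1 : ∀ t, 0 ≤ t → ‖∫ s in (0 : ℝ)..t, rot N V (s * ν)‖ ≤ ‖V‖ * t := by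
    intro t ht
    have := intervalIntegral.norm_integral_le_of_norm_le_const (a := 0) (b := t)
      (f := fun s : ℝ => rot N V (s * ν)) (C := ‖V‖) fun s _ => (norm_rot hN.star_eq V _).le
    rwa [sub_zero, abs_of_nonneg ht] at this
  have h2 := intervalIntegral.norm_integral_le_of_norm_le (a := 0) (b := 2 * Real.pi / ν)
    (μ := MeasureTheory.volume)
    (f := fun t => ∫ s in (0 : ℝ)..t, rot N V (s * ν)) (g := fun t => ‖V‖ * t) (by positivity)
    (Filter.Eventually.of_forall fun t ht => h1 t ht.1.le)
    ((by fun_prop : Continuous fun t : ℝ => ‖V‖ * t).intervalIntegrable _ _)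
  rw [intervalIntegral.integral_const_mul, integral_id] at h2
  rw [generator_eq, norm_smul, norm_mul, Complex.norm_I, Complex.norm_real, Real.norm_eq_abs,
    abs_of_pos (by positivity), one_mul]
  calc _ ≤ ν / (2 * Real.pi) * (‖V‖ * (((2 * Real.pi / ν) ^ 2 - 0 ^ 2) / 2)) := by gcongr
    _ = _ := by field_simp; ring

theorem star_generator (hN : IsNumberOp N) (ν : ℝ) {V : Op q Λ} (hV : star V = V) :
    star (generator ν N V) = -generator ν N V := by
  rw [generator_eq, star_smul, star_integral (continuous_integral_rot N V ν)]
  simp_rw [star_integral (continuous_rot_mul N V ν), star_rot hN.star_eq hV]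
  rw [← neg_smul]
  congr 1
  simp

end IsNumberOp

/-! ### Locality of averages and generators -/

/-- A linear projection onto the subalgebra is continuous in finite dimension, commutes with the
integral and fixes the integrand. -/
theorem integral_mem_localAlg {S : Finset Λ} {f : ℝ → Op q Λ} (hf : Continuous f)
    (h : ∀ s, f s ∈ localAlg q S) (a b : ℝ) : ∫ s in a..b, f s ∈ localAlg q S := by
  obtain ⟨g, hg⟩ := LinearMap.exists_leftInverse_of_injective
    (Subalgebra.toSubmodule (localAlg q S)).subtype (Submodule.ker_subtype _)
  let P : Op q Λ →L[ℂ] Op q Λ := LinearMap.toContinuousLinearMap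
    ((Subalgebra.toSubmodule (localAlg q S)).subtype ∘ₗ g)
  have hP : ∀ x ∈ localAlg q S, P x = x := fun x hx =>
    congrArg Subtype.val (LinearMap.congr_fun hg ⟨x, hx⟩)
  have hP' : ∀ x, P x ∈ localAlg q S := fun x => (g x).2
  have := P.intervalIntegral_comp_comm (hf.intervalIntegrable (μ := MeasureTheory.volume) a b)
  simp only [hP _ (h _)] at this
  rw [this]
  exact hP' _

namespace IsNumberFamily

variable {Nx : Λ → Op q Λ}

theorem commute (h : IsNumberFamily Nx) {x y : Λ} (hxy : x ≠ y) : Commute (Nx x) (Nx y) :=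
  (h.actsWithin x).commute (Finset.disjoint_singleton.2 hxy) (h.actsWithin y)

theorem isNumberOp_single (h : IsNumberFamily Nx) (x : Λ) : IsNumberOp (Nx x) where
  star_eq := (h.isHermitian x)
  exists_int z hz := by
    obtain ⟨n, hn⟩ := h.spectrum_subset x (spectrum.algebraMap_mem ℂ hz)
    refine ⟨n, ?_⟩
    have : ((n : ℝ) : ℂ) = (z : ℂ) := by simpa using hn
    exact_mod_cast this

theorem commute_sum (h : IsNumberFamily Nx) (s t : Finset Λ) :
    Commute (∑ x ∈ s, Nx x) (∑ x ∈ t, Nx x) := by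
  refine Commute.sum_left _ _ _ fun x _ => Commute.sum_right _ _ _ fun y _ => ?_
  by_cases hxy : x = y
  · subst hxy
    exact Commute.refl _
  · exact h.commute hxy

theorem exp_two_pi (h : IsNumberFamily Nx) (s : Finset Λ) :
    NormedSpace.exp ((I * ((2 * Real.pi : ℝ) : ℂ)) • ∑ x ∈ s, Nx x) = 1 := by
  classical
  let _ : NormedAlgebra ℚ (Op q Λ) := NormedAlgebra.restrictScalars ℚ ℂ _
  induction s using Finset.induction_on with
  | empty => simp [NormedSpace.exp_zero]
  | insert x s hx ih =>
    have hc : Commute (Nx x) (∑ y ∈ s, Nx y) := by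
      simpa using h.commute_sum {x} s
    rw [Finset.sum_insert hx, smul_add, NormedSpace.exp_add_of_commute
      ((hc.smul_left _).smul_right _), ih, (h.isNumberOp_single x).exp_two_pi, one_mul]

/-- The on-site terms commute, so `e^{2πiN}` is the product of the on-site exponentials, that is
`1`. Spectral mapping then forces every eigenvalue of `N` to be an integer. -/
theorem isNumberOp (h : IsNumberFamily Nx) : IsNumberOp (∑ x, Nx x) where
  star_eq := by
    rw [star_sum]
    exact Finset.sum_congr rfl fun x _ => h.isHermitian x
  exists_int z hz := by
    have hz' : (z : ℂ) ∈ spectrum ℂ (∑ x, Nx x) := spectrum.algebraMap_mem ℂ hz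
    have hc : I * ((2 * Real.pi : ℝ) : ℂ) ≠ 0 := by
      simp [Real.pi_ne_zero]
    have h1 : (I * ((2 * Real.pi : ℝ) : ℂ)) * (z : ℂ) ∈
        spectrum ℂ ((I * ((2 * Real.pi : ℝ) : ℂ)) • ∑ x, Nx x) :=
      (spectrum.smul_mem_smul_iff (r := Units.mk0 _ hc)).2 hz'
    have h2 := spectrum.exp_mem_exp _ h1
    rw [h.exp_two_pi, ← Complex.exp_eq_exp_ℂ] at h2
    have h3 : Complex.exp ((I * ((2 * Real.pi : ℝ) : ℂ)) * (z : ℂ)) = 1 := by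
      rcases subsingleton_or_nontrivial (Op q Λ) with hs | hs
      · rw [spectrum.of_subsingleton] at h2
        exact h2.elim
      · rw [spectrum.one_eq] at h2
        exact h2
    obtain ⟨n, hn⟩ := Complex.exp_eq_one_iff.1 h3
    refine ⟨n, ?_⟩
    have : (I * ((2 * Real.pi : ℝ) : ℂ)) * (z : ℂ) = (I * ((2 * Real.pi : ℝ) : ℂ)) * ((n : ℝ) : ℂ) := by
      rw [hn]; push_cast; ring
    exact_mod_cast (mul_left_cancel₀ hc this).symm

/-- The part of `N` outside `S` commutes with `O` and with the part inside, so its exponentials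
cancel and only the part inside `S` rotates `O`. -/
theorem rot_mem_localAlg (h : IsNumberFamily Nx) {S : Finset Λ} {O : Op q Λ}
    (hO : ActsWithin S O) (s : ℝ) : rot (∑ x, Nx x) O s ∈ localAlg q S := by
  classical
  let _ : NormedAlgebra ℚ (Op q Λ) := NormedAlgebra.restrictScalars ℚ ℂ _
  set NS := ∑ x ∈ S, Nx x with hNS
  set NT := ∑ x ∈ Sᶜ, Nx x with hNT
  have hsum : ∑ x, Nx x = NS + NT := (Finset.sum_add_sum_compl S Nx).symm
  have hc : Commute NS NT := h.commute_sum _ _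
  have hTO : Commute O NT := by
    refine Commute.sum_right _ _ _ fun y hy => hO.commute ?_ (h.actsWithin y)
    rw [Finset.disjoint_singleton_right]
    exact Finset.mem_compl.1 hy
  have hmem : NS ∈ localAlg q S := sum_mem fun x hx =>
    (h.actsWithin x).mono (Finset.singleton_subset_iff.2 hx)
  have hexp : ∀ c : ℂ, NormedSpace.exp (c • NS) ∈ localAlg q S := fun c =>
    NormedSpace.exp_mem (R := ℂ) (isClosed_localAlg S) ((localAlg q S).smul_mem hmem c)
  have e : rot (∑ x, Nx x) O s = rot NS O s := by
    have hc' : Commute O (NormedSpace.exp ((I * (s : ℂ)) • NT)) :=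
      ((hTO.symm.smul_left _).exp_left).symm
    rw [rot, rot, hsum, smul_add, smul_add, NormedSpace.exp_add_of_commute
      ((hc.smul_left _).smul_right _), add_comm ((-(I * (s : ℂ))) • NS),
      NormedSpace.exp_add_of_commute ((hc.symm.smul_left _).smul_right _)]
    have e2 : NormedSpace.exp ((I * (s : ℂ)) • NT) * NormedSpace.exp ((-(I * (s : ℂ))) • NT) = 1 := by
      rw [neg_smul]; exact exp_mul_exp_neg _
    calc _ = NormedSpace.exp ((I * (s : ℂ)) • NS) * (NormedSpace.exp ((I * (s : ℂ)) • NT) * O) *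
          (NormedSpace.exp ((-(I * (s : ℂ))) • NT) * NormedSpace.exp ((-(I * (s : ℂ))) • NS)) := by
          simp only [mul_assoc]
      _ = NormedSpace.exp ((I * (s : ℂ)) • NS) * O * (NormedSpace.exp ((I * (s : ℂ)) • NT) *
          NormedSpace.exp ((-(I * (s : ℂ))) • NT)) * NormedSpace.exp ((-(I * (s : ℂ))) • NS) := by
          rw [← hc'.eq]; simp only [mul_assoc]
      _ = _ := by rw [e2, mul_one]
  rw [e]
  exact mul_mem (mul_mem (hexp _) hO) (hexp _)

theorem actsWithin_average (h : IsNumberFamily Nx) {S : Finset Λ} {O : Op q Λ}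
    (hO : ActsWithin S O) : ActsWithin S (average (∑ x, Nx x) O) := by
  rw [h.isNumberOp.average_eq_integral]
  exact (localAlg q S).smul_mem
    (integral_mem_localAlg (continuous_rot _ _) (h.rot_mem_localAlg hO) _ _) _

theorem actsWithin_generator (h : IsNumberFamily Nx) {S : Finset Λ} {O : Op q Λ}
    (hO : ActsWithin S O) (ν : ℝ) : ActsWithin S (generator ν (∑ x, Nx x) O) := by
  rw [IsNumberOp.generator_eq]
  refine (localAlg q S).smul_mem (integral_mem_localAlg
    (IsNumberOp.continuous_integral_rot _ _ _) (fun t => ?_) _ _) _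
  exact integral_mem_localAlg (IsNumberOp.continuous_rot_mul _ _ _)
    (fun s => h.rot_mem_localAlg hO _) _ _

theorem isPotential_average (h : IsNumberFamily Nx) {Z : Finset Λ → Op q Λ} (hZ : IsPotential Z) :
    IsPotential (fun S => average (∑ x, Nx x) (Z S)) where
  actsWithin S := h.actsWithin_average (hZ.actsWithin S)
  eq_zero S hS := by rw [hZ.eq_zero S hS, average_zero]

theorem isPotential_generator (h : IsNumberFamily Nx) {Z : Finset Λ → Op q Λ}
    (hZ : IsPotential Z) (ν : ℝ) : IsPotential (fun S => generator ν (∑ x, Nx x) (Z S)) where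
  actsWithin S := h.actsWithin_generator (hZ.actsWithin S) ν
  eq_zero S hS := by
    rw [hZ.eq_zero S hS]
    simpa using IsNumberOp.generator_sum ∅ ν (∑ x, Nx x) (fun _ : Unit => (0 : Op q Λ))

end IsNumberFamily

/-! ### The scheme on the level of potentials -/

/-- The potential of the generator. -/
noncomputable def genPot (ν : ℝ) (N : Op q Λ) (Z : Finset Λ → Op q Λ) : Finset Λ → Op q Λ :=
  fun S => -generator ν N (offDiagPart N Z S)

/-- One step of the scheme. -/
noncomputable def stepPot (ν : ℝ) (N : Op q Λ) (Z : Finset Λ → Op q Λ) : Finset Λ → Op q Λ :=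
  diagPart N Z + remainder (genPot ν N Z) (diagPart N Z) (offDiagPart N Z)

/-- The potentials of the Hamiltonians `renHam`. -/
noncomputable def renPot (ν : ℝ) (N : Op q Λ) (H : Finset Λ → Op q Λ) :
    ℕ → Finset Λ → Op q Λ
  | 0 => H
  | n + 1 => stepPot ν N (renPot ν N H n)

theorem total_diagPart (N : Op q Λ) (Z : Finset Λ → Op q Λ) :
    total (diagPart N Z) = average N (total Z) := by
  rw [total, total, average_sum]
  rfl

theorem total_offDiagPart (N : Op q Λ) (Z : Finset Λ → Op q Λ) :
    total (offDiagPart N Z) = total Z - average N (total Z) := by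
  rw [← total_diagPart, ← total_sub]
  rfl

theorem total_genPot (ν : ℝ) (N : Op q Λ) (Z : Finset Λ → Op q Λ) :
    total (genPot ν N Z) = -generator ν N (total Z - average N (total Z)) := by
  rw [← total_offDiagPart, total, total, IsNumberOp.generator_sum, ← Finset.sum_neg_distrib]
  rfl

/-- The decay rates along the scheme of `k` steps. -/
noncomputable def rate (κ₀ : ℝ) (k : ℕ) : ℕ → ℝ
  | 0 => κ₀
  | n + 1 => κ₀ / 3 - n * (κ₀ / (6 * k))

theorem rate_ge {κ₀ : ℝ} (hκ₀ : 0 < κ₀) {k n : ℕ} (hn : n + 1 ≤ k) :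
    κ₀ / 6 ≤ rate κ₀ k (n + 1) := by
  have hk : (0 : ℝ) < k := by
    have : 0 < k := by omega
    exact_mod_cast this
  have hnk : (n : ℝ) ≤ k := by
    have : n ≤ k := by omega
    exact_mod_cast this
  have : (n : ℝ) * (κ₀ / (6 * k)) ≤ κ₀ / 6 := by
    calc (n : ℝ) * (κ₀ / (6 * k)) ≤ k * (κ₀ / (6 * k)) := by gcongr
      _ = κ₀ / 6 := by field_simp
  rw [rate]
  linarith

namespace IsNumberFamily

variable {Nx : Λ → Op q Λ} {N : Op q Λ}

theorem isPotential_diagPart (h : IsNumberFamily Nx) (hN : N = ∑ x, Nx x)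
    {Z : Finset Λ → Op q Λ} (hZ : IsPotential Z) : IsPotential (diagPart N Z) := by
  subst hN
  exact h.isPotential_average hZ

theorem isPotential_offDiagPart (h : IsNumberFamily Nx) (hN : N = ∑ x, Nx x)
    {Z : Finset Λ → Op q Λ} (hZ : IsPotential Z) : IsPotential (offDiagPart N Z) :=
  hZ.sub (h.isPotential_diagPart hN hZ)

theorem isPotential_genPot (h : IsNumberFamily Nx) (hN : N = ∑ x, Nx x) (ν : ℝ)
    {Z : Finset Λ → Op q Λ} (hZ : IsPotential Z) : IsPotential (genPot ν N Z) := by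
  have h1 := h.isPotential_offDiagPart hN hZ
  subst hN
  exact (h.isPotential_generator h1 ν).neg

theorem isPotential_stepRemainder (h : IsNumberFamily Nx) (hN : N = ∑ x, Nx x) (ν : ℝ)
    {Z : Finset Λ → Op q Λ} (hZ : IsPotential Z) :
    IsPotential (remainder (genPot ν N Z) (diagPart N Z) (offDiagPart N Z)) :=
  isPotential_remainder (h.isPotential_genPot hN ν hZ) (h.isPotential_diagPart hN hZ)
    (h.isPotential_offDiagPart hN hZ)

theorem isPotential_stepPot (h : IsNumberFamily Nx) (hN : N = ∑ x, Nx x) (ν : ℝ)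
    {Z : Finset Λ → Op q Λ} (hZ : IsPotential Z) : IsPotential (stepPot ν N Z) :=
  (h.isPotential_diagPart hN hZ).add (h.isPotential_stepRemainder hN ν hZ)

theorem isPotential_renPot (h : IsNumberFamily Nx) (hN : N = ∑ x, Nx x) (ν : ℝ)
    {H : Finset Λ → Op q Λ} (hH : IsPotential H) (n : ℕ) : IsPotential (renPot ν N H n) := by
  induction n with
  | zero => exact hH
  | succ n ih => exact h.isPotential_stepPot hN ν ih

theorem isNumberOp_of_eq (h : IsNumberFamily Nx) (hN : N = ∑ x, Nx x) : IsNumberOp N :=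
  hN ▸ h.isNumberOp

theorem total_stepPot (h : IsNumberFamily Nx) (hN : N = ∑ x, Nx x) {ν : ℝ} (hν : 0 < ν)
    {Z : Finset Λ → Op q Λ} (hZ : IsPotential Z) :
    total (stepPot ν N Z) =
      NormedSpace.exp (-generator ν N (total Z - average N (total Z))) *
        ((ν : ℂ) • N + total Z) *
        NormedSpace.exp (generator ν N (total Z - average N (total Z))) - (ν : ℂ) • N := by
  have hop := h.isNumberOp_of_eq hN
  -- The off-diagonal part has zero average, so its generator solves `[νN, A] = -V` exactly.
  have hav : average N (total Z - average N (total Z)) = 0 := by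
    rw [average_sub, hop.average_average, sub_self]
  have hc := hop.comm_generator hν (total Z - average N (total Z))
  rw [hav, zero_sub] at hc
  have hrem := total_remainder (n := (ν : ℂ) • N) (h.isPotential_genPot hN ν hZ)
    (h.isPotential_diagPart hN hZ) (h.isPotential_offDiagPart hN hZ) (by
      rw [total_genPot, total_offDiagPart, ← hc, mul_neg, neg_mul]
      abel1)
  rw [stepPot, total_add, hrem, total_genPot, total_diagPart, total_offDiagPart, neg_neg,
    add_sub_cancel, add_sub_cancel]

theorem total_renPot (h : IsNumberFamily Nx) (hN : N = ∑ x, Nx x) {ν : ℝ} (hν : 0 < ν)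
    {H : Finset Λ → Op q Λ} (hH : IsPotential H) (n : ℕ) :
    total (renPot ν N H n) = renHam ν N (total H) n := by
  induction n with
  | zero => rfl
  | succ n ih =>
    rw [renPot, renHam, h.total_stepPot hN hν (h.isPotential_renPot hN ν hH n), ih]

variable [Nonempty Λ]

theorem potNorm_average_le (h : IsNumberFamily Nx) (hN : N = ∑ x, Nx x) (κ : ℝ)
    {Z : Finset Λ → Op q Λ} (hZ : IsPotential Z) :
    potNorm κ (diagPart N Z) ≤ potNorm κ Z := by
  have := potNorm_mono (le_refl κ) hZ (h.isPotential_diagPart hN hZ) zero_le_one (fun S => by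
    rw [one_mul]; exact (h.isNumberOp_of_eq hN).norm_average_le (Z S))
  rwa [one_mul] at this

theorem potNorm_offDiagPart_le (h : IsNumberFamily Nx) (hN : N = ∑ x, Nx x) (κ : ℝ)
    {Z : Finset Λ → Op q Λ} (hZ : IsPotential Z) :
    potNorm κ (offDiagPart N Z) ≤ 2 * potNorm κ Z := by
  refine potNorm_mono (le_refl κ) hZ (h.isPotential_offDiagPart hN hZ) zero_le_two fun S => ?_
  have h1 := (h.isNumberOp_of_eq hN).norm_average_le (Z S)
  have h2 := norm_sub_le (Z S) (average N (Z S))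
  calc ‖offDiagPart N Z S‖ ≤ ‖Z S‖ + ‖average N (Z S)‖ := h2
    _ ≤ _ := by linarith

theorem diagPart_stepPot (h : IsNumberFamily Nx) (hN : N = ∑ x, Nx x) (ν : ℝ)
    (Z : Finset Λ → Op q Λ) :
    diagPart N (stepPot ν N Z) = diagPart N Z +
      diagPart N (remainder (genPot ν N Z) (diagPart N Z) (offDiagPart N Z)) := by
  funext S
  change average N (average N (Z S) + _) = average N (Z S) + average N _
  rw [average_add, (h.isNumberOp_of_eq hN).average_average]

/-- The old diagonal part is fixed by averaging, so the new off-diagonal part comes from the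
remainder alone. -/
theorem offDiagPart_stepPot (h : IsNumberFamily Nx) (hN : N = ∑ x, Nx x) (ν : ℝ)
    (Z : Finset Λ → Op q Λ) :
    offDiagPart N (stepPot ν N Z) =
      offDiagPart N (remainder (genPot ν N Z) (diagPart N Z) (offDiagPart N Z)) := by
  funext S
  have := congrFun (h.diagPart_stepPot hN ν Z) S
  change stepPot ν N Z S - diagPart N (stepPot ν N Z) S = _
  rw [this]
  change average N (Z S) + _ - (average N (Z S) + average N _) = _ - average N _
  abel1

/-- The norm estimates for one step. -/
theorem potNorm_step (h : IsNumberFamily Nx) (hN : N = ∑ x, Nx x) {ν : ℝ} (hν : 0 < ν)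
    {Z : Finset Λ → Op q Λ} (hZ : IsPotential Z) {κ κ' : ℝ} (hκ : κ' < κ) (hκ' : 0 < κ')
    (hsmall : 6 * (Real.pi / ν * potNorm κ (offDiagPart N Z)) ≤ κ - κ') :
    ∃ w, 0 ≤ w ∧
      w ≤ 12 / (κ - κ') * (1 / κ') * (Real.pi / ν) * potNorm κ (offDiagPart N Z) *
        (potNorm κ (diagPart N Z) + potNorm κ (offDiagPart N Z)) ∧
      potNorm κ' (diagPart N (stepPot ν N Z)) ≤ potNorm κ (diagPart N Z) + w ∧
      potNorm κ' (offDiagPart N (stepPot ν N Z)) ≤ 2 * w := by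
  have hpi := Real.pi_pos
  have hD := h.isPotential_diagPart hN hZ
  have hV := h.isPotential_offDiagPart hN hZ
  have hA := h.isPotential_genPot hN ν hZ
  have hW := h.isPotential_stepRemainder hN ν hZ
  have hd := sub_pos.2 hκ
  have hnA : potNorm κ (genPot ν N Z) ≤ Real.pi / ν * potNorm κ (offDiagPart N Z) := by
    refine potNorm_mono le_rfl hV hA (by positivity) fun S => ?_
    rw [genPot, norm_neg]
    exact (h.isNumberOp_of_eq hN).norm_generator_le hν _
  have hw := potNorm_remainder_le hκ hκ'.le hA hD hV (by linarith)
  have hexp : Real.exp (-κ') ≤ 1 / κ' := by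
    rw [Real.exp_neg, ← one_div]
    exact one_div_le_one_div_of_le hκ' (by have := Real.add_one_le_exp κ'; linarith)
  refine ⟨potNorm κ' (remainder (genPot ν N Z) (diagPart N Z) (offDiagPart N Z)),
    potNorm_nonneg _ _, hw.trans ?_, ?_, ?_⟩
  · have h1 := potNorm_nonneg κ (diagPart N Z)
    have h2 := potNorm_nonneg κ (offDiagPart N Z)
    have h3 := potNorm_nonneg κ (genPot ν N Z)
    calc _ ≤ 12 / (κ - κ') * (1 / κ') * (Real.pi / ν * potNorm κ (offDiagPart N Z)) *
          (potNorm κ (diagPart N Z) + potNorm κ (offDiagPart N Z)) := by gcongr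
      _ = _ := by ring
  · rw [h.diagPart_stepPot hN]
    have hDW := h.isPotential_diagPart hN hW
    refine (potNorm_add_le κ' hD hDW (hD.add hDW)).trans (add_le_add ?_ ?_)
    · have := potNorm_mono hκ.le hD hD zero_le_one (fun S => by rw [one_mul])
      rwa [one_mul] at this
    · exact h.potNorm_average_le hN κ' hW
  · rw [h.offDiagPart_stepPot hN]
    exact h.potNorm_offDiagPart_le hN κ' hW

/-- The norms along the scheme; here `r = ν / ν₀`. -/
theorem potNorm_renPot_le (h : IsNumberFamily Nx) (hN : N = ∑ x, Nx x) {ν : ℝ} (hν : 0 < ν)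
    {H : Finset Λ → Op q Λ} (hH : IsPotential H) {κ₀ r : ℝ} (hκ₀ : 0 < κ₀) {k : ℕ}
    (hr : 24 ≤ r) (hkr : 24 * (k : ℝ) ≤ r)
    (hscale : 54 * Real.pi / κ₀ ^ 2 * (potNorm κ₀ (diagPart N H) +
      2 * potNorm κ₀ (offDiagPart N H)) * r = ν)
    (hV : 9 * Real.pi * potNorm κ₀ (offDiagPart N H) / κ₀ ≤ ν) (n : ℕ) (hn : n + 1 ≤ k) :
    potNorm (rate κ₀ k (n + 1)) (offDiagPart N (renPot ν N H (n + 1))) ≤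
        2 / r * (2 / 3) ^ n * potNorm κ₀ (offDiagPart N H) ∧
      potNorm (rate κ₀ k (n + 1)) (diagPart N (renPot ν N H (n + 1))) +
        potNorm (rate κ₀ k (n + 1)) (offDiagPart N (renPot ν N H (n + 1))) ≤
        potNorm κ₀ (diagPart N H) + 3 / r * potNorm κ₀ (offDiagPart N H) := by
  have hpi := Real.pi_pos
  have hr0 : 0 < r := by linarith
  have hd0 := potNorm_nonneg κ₀ (diagPart N H)
  have hv0 := potNorm_nonneg κ₀ (offDiagPart N H)
  set d₀ := potNorm κ₀ (diagPart N H)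
  set v₀ := potNorm κ₀ (offDiagPart N H)
  -- This is the smallness `6‖A‖ ≤ κ - κ'` needed for the first step, where `κ - κ' = 2κ₀/3`; it is
  -- the source of `9π` in the hypothesis on `ν`.
  have hV' : Real.pi / ν * v₀ ≤ κ₀ / 9 := by
    rw [div_mul_eq_mul_div, div_le_iff₀ hν]
    rw [div_le_iff₀ hκ₀] at hV
    linarith
  have hS : Real.pi / ν * (d₀ + 2 * v₀) = κ₀ ^ 2 / (54 * r) := by
    rw [← hscale] at hν ⊢
    -- If this sum vanished, `hscale` would force `ν = 0`.
    have h2 : 0 < d₀ + 2 * v₀ := by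
      rcases (add_nonneg hd0 (mul_nonneg zero_le_two hv0)).eq_or_lt with h0 | h0
      · rw [← h0] at hν; simp at hν
      · exact h0
    field_simp
  induction n with
  | zero =>
    have hrate : rate κ₀ k (0 + 1) = κ₀ / 3 := by simp [rate]
    obtain ⟨w, hw0, hw, hd, hv⟩ := h.potNorm_step hN hν hH (κ := κ₀) (κ' := κ₀ / 3)
      (by linarith) (by positivity) (by
        change 6 * (Real.pi / ν * v₀) ≤ _
        linarith)
    have hwle : w ≤ v₀ / r := by
      refine hw.trans ?_
      -- The constant 54 in `ν₀` is this product, for the first drop of the rate from `κ₀` to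
      -- `κ₀/3`.
      have e : 12 / (κ₀ - κ₀ / 3) * (1 / (κ₀ / 3)) = 54 / κ₀ ^ 2 := by
        field_simp; norm_num
      rw [e]
      calc 54 / κ₀ ^ 2 * (Real.pi / ν) * v₀ * (d₀ + v₀)
          ≤ 54 / κ₀ ^ 2 * (Real.pi / ν) * v₀ * (d₀ + 2 * v₀) := by gcongr; linarith
        _ = 54 / κ₀ ^ 2 * v₀ * (Real.pi / ν * (d₀ + 2 * v₀)) := by ring
        _ = v₀ / r := by rw [hS]; field_simp
    rw [hrate]
    have e1 : 2 / r * (2 / 3) ^ 0 * v₀ = 2 * (v₀ / r) := by ring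
    have e2 : 3 / r * v₀ = 3 * (v₀ / r) := by ring
    rw [e1, e2]
    change potNorm (κ₀ / 3) (offDiagPart N (stepPot ν N H)) ≤ _ ∧
      potNorm (κ₀ / 3) (diagPart N (stepPot ν N H)) +
        potNorm (κ₀ / 3) (offDiagPart N (stepPot ν N H)) ≤ _
    constructor <;> linarith
  | succ n ih =>
    obtain ⟨ih1, ih2⟩ := ih (by omega)
    have hk : (0 : ℝ) < k := by
      have : 0 < k := by omega
      exact_mod_cast this
    set Z := renPot ν N H (n + 1) with hZ
    set κ := rate κ₀ k (n + 1) with hκ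
    set κ' := rate κ₀ k (n + 1 + 1) with hκ'
    have hdiff : κ - κ' = κ₀ / (6 * k) := by
      rw [hκ, hκ', rate, rate]; push_cast; ring
    have hge : κ₀ / 6 ≤ κ' := rate_ge hκ₀ hn
    have hpos : 0 < κ₀ / (6 * k) := by positivity
    have hv := potNorm_nonneg κ (offDiagPart N Z)
    have hd := potNorm_nonneg κ (diagPart N Z)
    have hpow : (2 / 3 : ℝ) ^ n ≤ 1 := pow_le_one₀ (by norm_num) (by norm_num)
    have hv1 : potNorm κ (offDiagPart N Z) ≤ 2 / r * v₀ := by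
      refine ih1.trans ?_
      have : 2 / r * (2 / 3) ^ n ≤ 2 / r := mul_le_of_le_one_right (by positivity) hpow
      gcongr
    obtain ⟨w, hw0, hw, hd', hv'⟩ := h.potNorm_step hN hν (h.isPotential_renPot hN ν hH (n + 1))
      (κ := κ) (κ' := κ') (by linarith) (by linarith) (by
        rw [hdiff]
        calc 6 * (Real.pi / ν * potNorm κ (offDiagPart N Z))
            ≤ 6 * (Real.pi / ν * (2 / r * v₀)) := by gcongr
          _ = 12 / r * (Real.pi / ν * v₀) := by ring
          _ ≤ 12 / r * (κ₀ / 9) := by gcongr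
          _ ≤ κ₀ / (6 * k) := by
            rw [div_mul_div_comm, div_le_div_iff₀ (by positivity) (by positivity)]
            nlinarith)
    rw [← hZ] at hw hd'
    have hwle : w ≤ potNorm κ (offDiagPart N Z) / 3 := by
      refine hw.trans ?_
      have e1 : 1 / κ' ≤ 6 / κ₀ := by
        rw [div_le_div_iff₀ (by linarith) hκ₀]; linarith
      have e2 : 3 / r * v₀ ≤ 2 * v₀ := by
        gcongr
        rw [div_le_iff₀ hr0]; linarith
      -- The bound on `‖D‖ + ‖V‖` is preserved along the induction: a step changes it to at most
      -- `‖D‖ + 3w`, and `w ≤ ‖V‖/3`.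
      have e3 : potNorm κ (diagPart N Z) + potNorm κ (offDiagPart N Z) ≤ d₀ + 2 * v₀ := by
        linarith
      rw [hdiff]
      calc _ ≤ 12 / (κ₀ / (6 * k)) * (6 / κ₀) * (Real.pi / ν) * potNorm κ (offDiagPart N Z) *
            (d₀ + 2 * v₀) := by gcongr
        _ = 432 * k / κ₀ ^ 2 * (Real.pi / ν * (d₀ + 2 * v₀)) * potNorm κ (offDiagPart N Z) := by
            field_simp; ring
        -- Here `432 = 12 · 6 · 6` and `432/54 = 8`; the condition `24 k ≤ r` makes the factor at
        -- most `1/3`, hence the contraction `2w ≤ (2/3)‖V‖`.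
        _ = (8 * k / r) * potNorm κ (offDiagPart N Z) := by
            rw [hS]; field_simp; ring
        _ ≤ 1 / 3 * potNorm κ (offDiagPart N Z) := by
            refine mul_le_mul_of_nonneg_right ?_ hv
            rw [div_le_iff₀ hr0]; linarith
        _ = _ := by ring
    change potNorm κ' (offDiagPart N (stepPot ν N Z)) ≤ _ ∧
      potNorm κ' (diagPart N (stepPot ν N Z)) +
        potNorm κ' (offDiagPart N (stepPot ν N Z)) ≤ _
    have e : 2 / r * (2 / 3) ^ (n + 1) * v₀ = 2 / 3 * (2 / r * (2 / 3) ^ n * v₀) := by ring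
    rw [e]
    constructor <;> linarith

end IsNumberFamily

/-! ### Commutators of extensive operators -/

/-- Double counting: each `S` is counted once for each of its sites. This is where the factor `|Λ|`
enters. -/
theorem sum_card_mul_norm_le [Nonempty Λ] {κ : ℝ} (hκ : 0 ≤ κ) {V : Finset Λ → Op q Λ}
    (hV : IsPotential V) : ∑ S, (S.card : ℝ) * ‖V S‖ ≤ Λ.card * potNorm κ V := by
  classical
  have e : ∑ S, (S.card : ℝ) * ‖V S‖ = ∑ x : Λ, ∑ S, if x ∈ S then ‖V S‖ else 0 := by
    rw [Finset.sum_comm]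
    refine Finset.sum_congr rfl fun S _ => ?_
    rw [Finset.sum_ite_mem, Finset.univ_inter, Finset.sum_const, nsmul_eq_mul]
  have e2 : (Λ.card : ℝ) * potNorm κ V = ∑ _x : Λ, potNorm κ V := by
    rw [Finset.sum_const, nsmul_eq_mul, Finset.card_univ, Fintype.card_coe]
  rw [e, e2]
  refine Finset.sum_le_sum fun x _ => ?_
  refine le_trans (le_of_eq ?_) ((siteSum_mono hκ x fun _ => le_rfl).trans (siteSum_le hV κ x))
  unfold siteSum
  refine Finset.sum_congr rfl fun S _ => ?_
  simp

theorem norm_commutator_total_le [Nonempty Λ] {κ : ℝ} (hκ : 0 ≤ κ) {V D : Finset Λ → Op q Λ}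
    (hV : IsPotential V) (hD : IsPotential D) :
    ‖total V * total D - total D * total V‖ ≤ 2 * Λ.card * potNorm κ V * potNorm κ D := by
  classical
  have hM : ∀ y : Λ, ∑ T, (if y ∈ T then ‖D T‖ else 0) ≤ potNorm κ D := by
    intro y
    refine le_trans (le_of_eq ?_) ((siteSum_mono hκ y fun _ => le_rfl).trans (siteSum_le hD κ y))
    unfold siteSum
    refine Finset.sum_congr rfl fun S _ => ?_
    simp
  have h1 := sum_overlap_le (f := fun S => ‖V S‖) (g := fun S => ‖D S‖)
    (fun S => norm_nonneg _) (fun S => norm_nonneg _) (fun _ => True) hM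
  simp only [true_and, if_true] at h1
  have h2 : ‖total V * total D - total D * total V‖ ≤
      ∑ S, ∑ T, 2 * (if ¬ Disjoint S T then ‖V S‖ * ‖D T‖ else 0) := by
    have e : total V * total D - total D * total V =
        ∑ S, ∑ T, (V S * D T - D T * V S) := by
      simp only [total, Finset.sum_mul_sum, Finset.sum_sub_distrib]
      rw [Finset.sum_comm (f := fun i j => D i * V j)]
    rw [e]
    refine (norm_sum_le _ _).trans (Finset.sum_le_sum fun S _ => ?_)
    refine (norm_sum_le _ _).trans (Finset.sum_le_sum fun T _ => ?_)
    by_cases h : Disjoint S T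
    · simp [h, ((hV.actsWithin S).commute h (hD.actsWithin T)).eq]
    · simp only [h, not_false_eq_true, if_true]
      refine (norm_sub_le _ _).trans ?_
      have := norm_mul_le (V S) (D T)
      have := norm_mul_le (D T) (V S)
      linarith
  simp_rw [← Finset.mul_sum] at h2
  have h3 := mul_le_mul_of_nonneg_right (sum_card_mul_norm_le hκ hV) (potNorm_nonneg κ D)
  calc _ ≤ 2 * (Λ.card * potNorm κ V * potNorm κ D) := by linarith
    _ = _ := by ring

theorem IsNumberFamily.norm_commutator_le [Nonempty Λ] {Nx : Λ → Op q Λ} (h : IsNumberFamily Nx)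
    {κ : ℝ} (hκ : 0 ≤ κ) {V : Finset Λ → Op q Λ} (hV : IsPotential V) :
    ‖total V * (∑ x, Nx x) - (∑ x, Nx x) * total V‖ ≤
      2 * Λ.card * (⨆ x, ‖Nx x‖) * potNorm κ V := by
  classical
  have hM : ∀ x, ‖Nx x‖ ≤ ⨆ x, ‖Nx x‖ := fun x =>
    le_ciSup (f := fun x => ‖Nx x‖) (Set.finite_range _).bddAbove x
  have hM0 : 0 ≤ ⨆ x, ‖Nx x‖ := Real.iSup_nonneg fun _ => norm_nonneg _
  have e : total V * (∑ x, Nx x) - (∑ x, Nx x) * total V =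
      ∑ S, ∑ x, (V S * Nx x - Nx x * V S) := by
    simp only [total, Finset.sum_mul_sum, Finset.sum_sub_distrib]
    rw [Finset.sum_comm (f := fun i j => Nx i * V j)]
  rw [e]
  calc _ ≤ ∑ S, ∑ x, (if x ∈ S then 2 * (⨆ x, ‖Nx x‖) * ‖V S‖ else 0) := by
        refine (norm_sum_le _ _).trans (Finset.sum_le_sum fun S _ => ?_)
        refine (norm_sum_le _ _).trans (Finset.sum_le_sum fun x _ => ?_)
        split_ifs with hx
        · refine (norm_sub_le _ _).trans ?_
          have h1 := norm_mul_le (V S) (Nx x)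
          have h2 := norm_mul_le (Nx x) (V S)
          have h3 := mul_le_mul_of_nonneg_right (hM x) (norm_nonneg (V S))
          linarith
        · rw [((hV.actsWithin S).commute (Finset.disjoint_singleton_right.2 hx)
            (h.actsWithin x)).eq, sub_self, norm_zero]
    _ = 2 * (⨆ x, ‖Nx x‖) * ∑ S, (S.card : ℝ) * ‖V S‖ := by
        rw [Finset.mul_sum]
        refine Finset.sum_congr rfl fun S _ => ?_
        rw [Finset.sum_ite_mem, Finset.univ_inter, Finset.sum_const, nsmul_eq_mul]
        ring
    _ ≤ 2 * (⨆ x, ‖Nx x‖) * (Λ.card * potNorm κ V) := by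
        gcongr
        exact sum_card_mul_norm_le hκ hV
    _ = _ := by ring

/-! ### Dressed operators -/

theorem IsNumberOp.star_renHam {N H : Op q Λ} (hN : IsNumberOp N) (hH : star H = H) (ν : ℝ)
    (n : ℕ) : star (renHam ν N H n) = renHam ν N H n := by
  induction n with
  | zero => exact hH
  | succ n ih =>
    have hV : star (renHam ν N H n - average N (renHam ν N H n)) =
        renHam ν N H n - average N (renHam ν N H n) := by
      rw [star_sub, ih, star_average N ih]
    have hg := hN.star_generator ν hV
    rw [renHam, star_sub, star_mul, star_mul, NormedSpace.star_exp, NormedSpace.star_exp, star_neg,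
      hg, neg_neg, star_add, star_smul, ih, hN.star_eq, mul_assoc]
    simp

theorem IsNumberOp.star_renGen {N H : Op q Λ} (hN : IsNumberOp N) (hH : star H = H) (ν : ℝ)
    (n : ℕ) : star (renGen ν N H n) = -renGen ν N H n := by
  refine hN.star_generator ν ?_
  rw [star_sub, hN.star_renHam hH, star_average N (hN.star_renHam hH ν n)]

theorem IsNumberOp.dressing_mem_unitary {N H : Op q Λ} (hN : IsNumberOp N) (hH : star H = H)
    (ν : ℝ) (k : ℕ) : dressing ν N H k ∈ unitary (Op q Λ) := by
  induction k with
  | zero => exact one_mem _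
  | succ k ih =>
    refine mul_mem (exp_mem_unitary ?_) ih
    rw [star_neg, hN.star_renGen hH]

theorem dressing_mul {N H : Op q Λ} (ν : ℝ) (k : ℕ) :
    dressing ν N H k * ((ν : ℂ) • N + H) = ((ν : ℂ) • N + renHam ν N H k) * dressing ν N H k := by
  induction k with
  | zero => simp [dressing, renHam]
  | succ k ih =>
    have e : (ν : ℂ) • N + renHam ν N H (k + 1) = NormedSpace.exp (-renGen ν N H k) *
        ((ν : ℂ) • N + renHam ν N H k) * NormedSpace.exp (renGen ν N H k) := by
      rw [renHam, renGen]; abel1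
    rw [e, dressing, mul_assoc, ih]
    calc _ = NormedSpace.exp (-renGen ν N H k) * ((ν : ℂ) • N + renHam ν N H k) *
          (1 * dressing ν N H k) := by rw [one_mul, mul_assoc]
      _ = _ := by rw [← exp_mul_exp_neg (renGen ν N H k)]; simp only [mul_assoc]

/-- The unitary `Y` turns `G` into `νN + H_k`, so `[G, Y* O Y] = Y* [νN + H_k, O] Y`, and `νN` drops
out because it commutes with `O`. -/
theorem IsNumberOp.norm_dressed_sub_le {N H : Op q Λ} (hN : IsNumberOp N) (hH : star H = H)
    (ν : ℝ) (k : ℕ) (O : Op q Λ) (hO : Commute N O) {t : ℝ} (ht : 0 ≤ t) :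
    ‖star (evolution ν N H t) * dressed ν N H k O * evolution ν N H t - dressed ν N H k O‖ ≤
      t * ‖(renHam ν N H k) * O - O * renHam ν N H k‖ := by
  set G := (ν : ℂ) • N + H with hG
  set Y := dressing ν N H k with hY
  have hGs : star G = G := by
    rw [hG, star_add, star_smul, hN.star_eq, hH]; simp
  have hYu : Y ∈ unitary (Op q Λ) := hN.dressing_mem_unitary hH ν k
  have hev : star (evolution ν N H t) = NormedSpace.exp ((I * (t : ℂ)) • G) := by
    rw [evolution, ← star_exp_rot_arg hGs, star_star]
  have e1 : star (evolution ν N H t) * dressed ν N H k O * evolution ν N H t =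
      rot G (dressed ν N H k O) t := by
    rw [hev]; rfl
  rw [e1]
  refine (norm_conj_exp_sub_le hGs ht).trans (mul_le_mul_of_nonneg_left (le_of_eq ?_) ht)
  have hYG : Y * G = ((ν : ℂ) • N + renHam ν N H k) * Y := dressing_mul ν k
  have hGY : G * star Y = star Y * ((ν : ℂ) • N + renHam ν N H k) := by
    have := congrArg (fun X => star Y * X * star Y) hYG
    have h1 : star Y * Y = 1 := Unitary.star_mul_self_of_mem hYu
    have h2 : Y * star Y = 1 := Unitary.mul_star_self_of_mem hYu
    calc G * star Y = star Y * Y * G * star Y := by rw [h1, one_mul]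
      _ = star Y * (Y * G) * star Y := by rw [mul_assoc (star Y)]
      _ = star Y * ((ν : ℂ) • N + renHam ν N H k) * (Y * star Y) := by
          rw [hYG]; simp only [mul_assoc]
      _ = _ := by rw [h2, mul_one]
  have hcomm : G * dressed ν N H k O - dressed ν N H k O * G =
      star Y * (renHam ν N H k * O - O * renHam ν N H k) * star (star Y) := by
    have hO' : N * O = O * N := hO
    rw [star_star, dressed, ← hY, mul_assoc (star Y * O), hYG]
    rw [← mul_assoc G, ← mul_assoc G, hGY]
    simp only [mul_assoc, mul_sub, sub_mul, mul_add, add_mul, smul_mul_assoc, mul_smul_comm]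
    rw [← mul_assoc N O, hO', mul_assoc]
    abel1
  rw [hcomm]
  exact norm_unitary_conj (Unitary.star_mem hYu) _

/-! ### Conservation of the dressed operators -/

theorem nuZero_nonneg (κ₀ : ℝ) (N : Op q Λ) (H : Finset Λ → Op q Λ) : 0 ≤ nuZero κ₀ N H := by
  have := Real.pi_pos
  have h1 := potNorm_nonneg κ₀ (diagPart N H)
  have h2 := potNorm_nonneg κ₀ (offDiagPart N H)
  unfold nuZero
  positivity

/-- For `ν₀ = 0` the conventions `ν / 0 = 0` and `log 0 = 0` give `n_* = -2`, so positivity need not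
be assumed separately. -/
theorem nuZero_pos_of_one_le_nStar {ν ν₀ : ℝ} (h0 : 0 ≤ ν₀) (h1 : 1 ≤ nStar ν ν₀) : 0 < ν₀ := by
  rcases h0.eq_or_lt with h | h
  · rw [← h] at h1
    simp [nStar] at h1
  · exact h

/-- The condition `1 ≤ n_*` makes `ν / ν₀` large. -/
theorem ratio_bounds {r : ℝ} (hr : 1 ≤ r) (h : 1 ≤ ⌊r / (1 + Real.log r) ^ 3⌋ - 2) :
    24 ≤ r ∧ 64 ≤ (1 + Real.log r) ^ 3 := by
  have h3 : (3 : ℝ) ≤ r / (1 + Real.log r) ^ 3 := by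
    have : (3 : ℤ) ≤ ⌊r / (1 + Real.log r) ^ 3⌋ := by linarith
    exact_mod_cast Int.le_floor.1 this
  have hl := Real.log_nonneg hr
  have hpos : 0 < (1 + Real.log r) ^ 3 := by positivity
  rw [le_div_iff₀ hpos] at h3
  have hr0 : 0 < r := by linarith
  have key : ∀ a : ℝ, 0 ≤ a → a ≤ Real.log r → 3 * (1 + a) ^ 3 ≤ r := by
    intro a ha hal
    refine le_trans ?_ h3
    gcongr
  have e1 := Real.exp_one_lt_d9
  -- Bootstrap: `r ≥ 3` gives `log r ≥ 1`, hence `r ≥ 24`, hence `log r ≥ 3` because `e³ < 24`.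
  have l0 := key 0 le_rfl hl
  have l1 : 1 ≤ Real.log r := by
    rw [Real.le_log_iff_exp_le hr0]; linarith
  have l2 := key 1 zero_le_one l1
  have l3 : 3 ≤ Real.log r := by
    rw [Real.le_log_iff_exp_le hr0]
    have : Real.exp 3 = Real.exp 1 ^ 3 := by rw [← Real.exp_nat_mul]; norm_num
    rw [this]
    have : Real.exp 1 ^ 3 ≤ 2.72 ^ 3 := by gcongr; linarith
    norm_num at this l2 ⊢
    linarith
  refine ⟨by norm_num at l2; linarith, ?_⟩
  calc (64 : ℝ) = (1 + 3) ^ 3 := by norm_num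
    _ ≤ _ := by gcongr

theorem dressed_conservation (hΛ : Λ.Nonempty) {Nx : Λ → Op q Λ} {H : Finset Λ → Op q Λ}
    {κ₀ ν : ℝ} (hadm : Admissible Nx H κ₀ ν) {N : Op q Λ} (hN : N = ∑ x, Nx x) {k : ℕ}
    (hk : (k : ℤ) = nStar ν (nuZero κ₀ N H) ∨ (k : ℤ) = nStar ν (nuZero κ₀ N H) + 1)
    {t : ℝ} (ht : 0 ≤ t) :
    (1 / (Λ.card : ℝ)) * ‖star (evolution ν N (total H) t) *
        dressed ν N (total H) k (effHam ν N (total H) k) * evolution ν N (total H) t -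
        dressed ν N (total H) k (effHam ν N (total H) k)‖ ≤
      t * (6 * (potNorm κ₀ (diagPart N H) + nuZero κ₀ N H / ν * potNorm κ₀ (offDiagPart N H)) *
        potNorm κ₀ (offDiagPart N H)) * (2 / 3 : ℝ) ^ nStar ν (nuZero κ₀ N H) ∧
    (1 / (Λ.card : ℝ)) * ‖star (evolution ν N (total H) t) *
        dressed ν N (total H) k N * evolution ν N (total H) t - dressed ν N (total H) k N‖ ≤
      t * (6 * (⨆ x, ‖Nx x‖) * potNorm κ₀ (offDiagPart N H)) *
        (2 / 3 : ℝ) ^ nStar ν (nuZero κ₀ N H) := by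
  have : Nonempty Λ := hΛ.to_subtype
  have h := hadm.number
  have hκ₀ := hadm.decay_pos
  have hV := hadm.scale_V
  have hνν := hadm.scale_nuZero
  have h1 := hadm.one_le_nStar
  rw [← hN] at hV hνν h1
  have hν₀ : 0 < nuZero κ₀ N H := nuZero_pos_of_one_le_nStar (nuZero_nonneg _ _ _) h1
  have hν : 0 < ν := hν₀.trans_le hνν
  set ν₀ := nuZero κ₀ N H with hν₀def
  set r := ν / ν₀ with hr
  have hr1 : 1 ≤ r := (one_le_div hν₀).2 hνν
  obtain ⟨hr24, hL⟩ := ratio_bounds hr1 h1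
  have hr0 : 0 < r := by linarith
  -- Both choices of `k` are below the floor, so `k (1 + log r)³ ≤ r`, and the cube is at least 64.
  have hkr : 24 * (k : ℝ) ≤ r := by
    have e1 : (k : ℤ) ≤ ⌊r / (1 + Real.log r) ^ 3⌋ := by
      have e0 : nStar ν ν₀ = ⌊r / (1 + Real.log r) ^ 3⌋ - 2 := rfl
      rcases hk with hk | hk <;> (rw [hk, e0]; linarith)
    have e2 := Int.le_floor.1 e1
    rw [le_div_iff₀ (by linarith)] at e2
    push_cast at e2
    have hk0 : (0 : ℝ) ≤ k := Nat.cast_nonneg k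
    nlinarith
  obtain ⟨j, rfl⟩ : ∃ j, k = j + 1 := by
    refine ⟨k - 1, ?_⟩
    have : (1 : ℤ) ≤ k := by rcases hk with hk | hk <;> (rw [hk]; linarith)
    omega
  have hop := h.isNumberOp_of_eq hN
  have hHs : star (total H) = total H := hadm.isHermitian
  have hscale : 54 * Real.pi / κ₀ ^ 2 * (potNorm κ₀ (diagPart N H) +
      2 * potNorm κ₀ (offDiagPart N H)) * r = ν := by
    change ν₀ * (ν / ν₀) = ν
    field_simp
  obtain ⟨b1, b2⟩ := h.potNorm_renPot_le hN hν hadm.potential hκ₀ hr24 hkr hscale hV j le_rfl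
  have hrate : 0 ≤ rate κ₀ (j + 1) (j + 1) :=
    le_trans (by positivity) (rate_ge hκ₀ le_rfl)
  have hZ := h.isPotential_renPot hN ν hadm.potential (j + 1)
  have htot := h.total_renPot hN hν hadm.potential (j + 1)
  set Z := renPot ν N H (j + 1)
  set κ := rate κ₀ (j + 1) (j + 1)
  have hD := h.isPotential_diagPart hN hZ
  have hVp := h.isPotential_offDiagPart hN hZ
  have hd0 := potNorm_nonneg κ₀ (diagPart N H)
  have hv0 := potNorm_nonneg κ₀ (offDiagPart N H)
  have hdk := potNorm_nonneg κ (diagPart N Z)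
  have hvk := potNorm_nonneg κ (offDiagPart N Z)
  set d₀ := potNorm κ₀ (diagPart N H)
  set v₀ := potNorm κ₀ (offDiagPart N H)
  set p := (2 / 3 : ℝ) ^ nStar ν ν₀ with hp
  have hp0 : 0 < p := zpow_pos (by norm_num) _
  have hpk : (2 / 3 : ℝ) ^ (j + 1) ≤ p := by
    rw [← zpow_natCast, hp]
    refine zpow_le_zpow_right_of_le_one₀ (by norm_num) (by norm_num) ?_
    rcases hk with hk | hk
    · exact hk.ge
    · rw [hk]; linarith
  -- The estimate after `j + 1` steps carries only `(2/3)^j`; the prefactor `2/r ≤ 2/3` supplies the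
  -- missing power.
  have hvle : potNorm κ (offDiagPart N Z) ≤ p * v₀ := by
    refine b1.trans (mul_le_mul_of_nonneg_right (le_trans ?_ hpk) hv0)
    rw [pow_succ, mul_comm]
    gcongr
    linarith
  have hdle : potNorm κ (diagPart N Z) ≤ d₀ + 3 * (ν₀ / ν * v₀) := by
    have : 3 / r * v₀ = 3 * (ν₀ / ν * v₀) := by
      rw [hr]; field_simp
    linarith
  have hcard : (0 : ℝ) < Λ.card := by exact_mod_cast Finset.card_pos.2 hΛ
  have htV : total (offDiagPart N Z) = renHam ν N (total H) (j + 1) -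
      average N (renHam ν N (total H) (j + 1)) := by rw [total_offDiagPart, htot]
  have htD : total (diagPart N Z) = average N (renHam ν N (total H) (j + 1)) := by
    rw [total_diagPart, htot]
  constructor
  · have e1 := hop.norm_dressed_sub_le hHs ν (j + 1) (effHam ν N (total H) (j + 1))
      (hop.commute_average _) ht
    have e2 := norm_commutator_total_le hrate hVp hD
    rw [htV, htD] at e2
    -- `⟨H_k⟩` commutes with itself, so `H_k` may be replaced by `V_k` in the commutator.
    have e3 : (renHam ν N (total H) (j + 1) - average N (renHam ν N (total H) (j + 1))) *
        average N (renHam ν N (total H) (j + 1)) - average N (renHam ν N (total H) (j + 1)) *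
        (renHam ν N (total H) (j + 1) - average N (renHam ν N (total H) (j + 1))) =
        renHam ν N (total H) (j + 1) * effHam ν N (total H) (j + 1) -
        effHam ν N (total H) (j + 1) * renHam ν N (total H) (j + 1) := by
      rw [effHam, sub_mul, mul_sub]; abel
    rw [e3] at e2
    have hx : 0 ≤ ν₀ / ν * v₀ := by positivity
    calc _ ≤ (1 / (Λ.card : ℝ)) * (t * (2 * Λ.card * (p * v₀) * (3 * (d₀ + ν₀ / ν * v₀)))) := by
          refine mul_le_mul_of_nonneg_left (e1.trans (mul_le_mul_of_nonneg_left (e2.trans ?_) ht))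
            (by positivity)
          gcongr
          linarith
      _ = _ := by field_simp; ring
  · have e1 := hop.norm_dressed_sub_le hHs ν (j + 1) N (Commute.refl N) ht
    have e2 := h.norm_commutator_le hrate hVp
    rw [← hN, htV] at e2
    have e3 : (renHam ν N (total H) (j + 1) - average N (renHam ν N (total H) (j + 1))) * N -
        N * (renHam ν N (total H) (j + 1) - average N (renHam ν N (total H) (j + 1))) =
        renHam ν N (total H) (j + 1) * N - N * renHam ν N (total H) (j + 1) := by
      rw [sub_mul, mul_sub, (hop.commute_average _).eq]; abel
    rw [e3] at e2
    have hM0 : 0 ≤ ⨆ x, ‖Nx x‖ := Real.iSup_nonneg fun _ => norm_nonneg _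
    calc _ ≤ (1 / (Λ.card : ℝ)) * (t * (2 * Λ.card * (⨆ x, ‖Nx x‖) * (p * v₀))) := by
          refine mul_le_mul_of_nonneg_left (e1.trans (mul_le_mul_of_nonneg_left (e2.trans ?_) ht))
            (by positivity)
          gcongr
      _ = t * (2 * (⨆ x, ‖Nx x‖) * v₀) * p := by field_simp
      _ ≤ _ := by gcongr; norm_num

/-! ### The Fermi–Hubbard chain -/

section Hubbard

variable {Λ : Volume 1}

/-! ### Single-mode operators and the doublon number -/

theorem occ_ext {a b : Fin 4} (h : ∀ τ, occ a τ = occ b τ) : a = b := by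
  revert a b; decide

theorem conf_ext {η ζ : Λ → Fin 4} (h : ∀ y τ, occ (η y) τ = occ (ζ y) τ) : η = ζ :=
  funext fun y => occ_ext (h y)

theorem annih_ne_zero {x : Λ} {σ : Fin 2} {η' η : Λ → Fin 4} (h : annih x σ η' η ≠ 0) :
    occ (η x) σ = true ∧ occ (η' x) σ = false ∧
      ∀ y τ, (y, τ) ≠ (x, σ) → occ (η' y) τ = occ (η y) τ := by
  classical
  by_contra hc
  apply h
  rw [annih, Matrix.of_apply]
  exact if_neg hc

theorem annih_of_occ {x : Λ} {σ : Fin 2} {η' η : Λ → Fin 4} (h : occ (η x) σ = true ∧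
    occ (η' x) σ = false ∧ ∀ y τ, (y, τ) ≠ (x, σ) → occ (η' y) τ = occ (η y) τ) :
    annih x σ η' η = (-1 : ℂ) ^ occBefore η x σ := by
  classical
  rw [annih, Matrix.of_apply]
  exact if_pos h

theorem exists_annih (x : Λ) (σ : Fin 2) (η : Λ → Fin 4) (h : occ (η x) σ = true) :
    ∃ η', annih x σ η' η = (-1 : ℂ) ^ occBefore η x σ := by
  classical
  have key : ∀ (a : Fin 4) (σ : Fin 2), ∃ b, occ b σ = false ∧ ∀ τ, τ ≠ σ → occ b τ = occ a τ := by
    decide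
  obtain ⟨b, hb, hb'⟩ := key (η x) σ
  refine ⟨Function.update η x b, annih_of_occ ⟨h, by simpa using hb, fun y τ hy => ?_⟩⟩
  by_cases hyx : y = x
  · subst hyx
    have : τ ≠ σ := fun h => hy (by rw [h])
    simpa using hb' τ this
  · simp [hyx]

/-- The Jordan–Wigner sign squares to one, leaving the projection onto the occupied mode. Both the
norm bound for `annih` and the diagonal form of `doublon` follow from this. -/
theorem star_annih_mul_annih (x : Λ) (σ : Fin 2) :
    star (annih x σ) * annih x σ =
      Matrix.diagonal fun η : Λ → Fin 4 => if occ (η x) σ = true then (1 : ℂ) else 0 := by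
  classical
  ext η η'
  have hmul : (star (annih x σ) * annih x σ) η η' =
      ∑ ζ, star (annih x σ ζ η) * annih x σ ζ η' := by
    rw [Matrix.mul_apply]; rfl
  rw [hmul, Matrix.diagonal_apply]
  by_cases hη : occ (η x) σ = true
  · obtain ⟨ζ, hζ⟩ := exists_annih x σ η hη
    have hne : annih x σ ζ η ≠ 0 := by rw [hζ]; simp
    obtain ⟨-, z2, z3⟩ := annih_ne_zero hne
    rw [Finset.sum_eq_single ζ]
    · by_cases h : η = η'
      · subst h
        rw [if_pos rfl, if_pos hη, hζ, star_pow, star_neg, star_one, ← mul_pow]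
        simp
      · rw [if_neg h]
        by_contra hc
        obtain ⟨w1, w2, w3⟩ := annih_ne_zero (right_ne_zero_of_mul hc)
        refine h (conf_ext fun y τ => ?_)
        by_cases hy : (y, τ) = (x, σ)
        · obtain ⟨rfl, rfl⟩ := Prod.mk.inj hy
          rw [hη, w1]
        · rw [← z3 y τ hy, w3 y τ hy]
    · intro ζ' _ hζ'
      by_contra hc
      have h0 : annih x σ ζ' η ≠ 0 := by
        intro h0; rw [h0] at hc; simp at hc
      obtain ⟨-, w2, w3⟩ := annih_ne_zero h0
      refine hζ' (conf_ext fun y τ => ?_)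
      by_cases hy : (y, τ) = (x, σ)
      · obtain ⟨rfl, rfl⟩ := Prod.mk.inj hy
        rw [z2, w2]
      · rw [z3 y τ hy, w3 y τ hy]
    · intro h; exact absurd (Finset.mem_univ _) h
  · rw [if_neg hη, ite_self]
    refine Finset.sum_eq_zero fun ζ _ => ?_
    have : annih x σ ζ η = 0 := by
      by_contra h
      exact hη (annih_ne_zero h).1
    rw [this, star_zero, zero_mul]

theorem norm_annih_le (x : Λ) (σ : Fin 2) : ‖annih x σ‖ ≤ 1 := by
  have h : ‖star (annih x σ) * annih x σ‖ ≤ 1 := by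
    rw [star_annih_mul_annih, Matrix.l2_opNorm_diagonal, pi_norm_le_iff_of_nonneg zero_le_one]
    intro η
    split_ifs <;> simp
  rw [CStarRing.norm_star_mul_self] at h
  nlinarith [norm_nonneg (annih x σ)]

theorem actsWithin_diagonal {S : Finset Λ} {f : (Λ → Fin 4) → ℂ}
    (hf : ∀ η ζ : Λ → Fin 4, (∀ x ∈ S, η x = ζ x) → f η = f ζ) :
    ActsWithin S (Matrix.diagonal f) := by
  classical
  refine ⟨Matrix.diagonal fun ξ => f (extendConf S (fun _ => 0) ξ), ?_⟩
  ext η η'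
  rw [embed_apply, Matrix.diagonal_apply]
  by_cases h : η = η'
  · subst h
    simp only [implies_true, if_true, Matrix.diagonal_apply_eq]
    exact hf _ _ fun x hx => by simp [extendConf, hx]
  · rw [if_neg h]
    split_ifs with h1
    · rw [Matrix.diagonal_apply_ne]
      intro h2
      refine h (funext fun x => ?_)
      by_cases hx : x ∈ S
      · exact congrFun h2 ⟨x, hx⟩
      · exact h1 x hx
    · rfl

theorem doublon_eq (x : Λ) : doublon x = Matrix.diagonal fun η : Λ → Fin 4 =>
    (if occ (η x) 1 = true then (1 : ℂ) else 0) * (if occ (η x) 0 = true then (1 : ℂ) else 0) := by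
  rw [doublon, star_annih_mul_annih, star_annih_mul_annih, Matrix.diagonal_mul_diagonal]

theorem isNumberFamily_doublon : IsNumberFamily (doublon : Λ → Op 4 Λ) where
  actsWithin x := by
    rw [doublon_eq]
    refine actsWithin_diagonal fun η ζ h => ?_
    rw [h x (Finset.mem_singleton_self x)]
  isHermitian x := by
    rw [doublon_eq, Matrix.isHermitian_diagonal_iff]
    intro η
    split_ifs <;> simp
  spectrum_subset x := by
    rw [doublon_eq, spectrum_diagonal]
    rintro _ ⟨η, rfl⟩
    dsimp only
    split_ifs
    · exact ⟨1, by simp⟩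
    all_goals exact ⟨0, by simp⟩

/-! ### Locality of the hopping terms -/

/-- The annihilation operator without its Jordan–Wigner sign. -/
noncomputable def lower (x : Λ) (σ : Fin 2) : Op 4 Λ :=
  open Classical in
  Matrix.of fun η' η =>
    if occ (η x) σ = true ∧ occ (η' x) σ = false ∧
        (∀ y τ, (y, τ) ≠ (x, σ) → occ (η' y) τ = occ (η y) τ) then 1 else 0

theorem annih_eq_lower_mul (x : Λ) (σ : Fin 2) :
    annih x σ = lower x σ * Matrix.diagonal fun η => (-1 : ℂ) ^ occBefore η x σ := by
  classical
  ext η' η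
  rw [Matrix.mul_diagonal, annih, lower, Matrix.of_apply, Matrix.of_apply, ite_mul, one_mul,
    zero_mul]

theorem actsWithin_lower (x : Λ) (σ : Fin 2) : ActsWithin {x} (lower x σ) := by
  classical
  have hx : x ∈ ({x} : Finset Λ) := Finset.mem_singleton_self x
  refine ⟨Matrix.of fun ξ' ξ => if occ (ξ ⟨x, hx⟩) σ = true ∧ occ (ξ' ⟨x, hx⟩) σ = false ∧
      (∀ τ, τ ≠ σ → occ (ξ' ⟨x, hx⟩) τ = occ (ξ ⟨x, hx⟩) τ) then 1 else 0, ?_⟩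
  ext η' η
  rw [embed_apply, lower, Matrix.of_apply, Matrix.of_apply, ← ite_and]
  refine if_congr ⟨?_, ?_⟩ rfl rfl
  · rintro ⟨h1, h2, h3⟩
    refine ⟨fun y hy => occ_ext fun τ => h3 y τ ?_, h1, h2, fun τ hτ => h3 x τ ?_⟩
    · rintro ⟨⟩; exact hy hx
    · rintro ⟨⟩; exact hτ rfl
  · rintro ⟨h0, h1, h2, h3⟩
    refine ⟨h1, h2, fun y τ hy => ?_⟩
    by_cases hyx : y = x
    · subst hyx
      exact h3 τ fun h => hy (by rw [h])
    · rw [h0 y (by simpa using hyx)]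

theorem actsWithin_star {d q : ℕ} {Λ : Volume d} {S : Finset Λ} {M : Op q Λ}
    (h : ActsWithin S M) : ActsWithin S (star M) := by
  classical
  obtain ⟨O, rfl⟩ := h
  refine ⟨star O, ?_⟩
  ext η η'
  rw [Matrix.star_apply, embed_apply, embed_apply, Matrix.star_apply]
  by_cases h : ∀ x, x ∉ S → η x = η' x
  · rw [if_pos h, if_pos fun x hx => (h x hx).symm]
  · rw [if_neg h, if_neg fun h' => h fun x hx => (h' x hx).symm, star_zero]

theorem adj_iff {x y : Λ} : (latticeGraph 1).Adj x.val y.val ↔ |x.val 0 - y.val 0| = 1 := by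
  simp [latticeGraph]

theorem site_ext {x y : Λ} (h : x.val 0 = y.val 0) : x = y := by
  refine Subtype.ext (funext fun i => ?_)
  rw [Subsingleton.elim i 0, h]

/-- The occupied modes from `(x, σ)` on and before `(y, σ)`, for neighbours `x < y`. -/
theorem occBefore_succ (η : Λ → Fin 4) {x y : Λ} (h : y.val 0 = x.val 0 + 1) (σ : Fin 2) :
    open Classical in
    occBefore η y σ = occBefore η x σ + (Finset.univ.filter fun p : Λ × Fin 2 =>
      ((p.1 = x ∧ ¬ p.2 < σ) ∨ (p.1 = y ∧ p.2 < σ)) ∧ occ (η p.1) p.2 = true).card := by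
  classical
  have hxy : x ≠ y := by rintro rfl; omega
  unfold occBefore
  rw [← Finset.card_union_of_disjoint]
  · congr 1
    ext p
    simp only [Finset.mem_filter, Finset.mem_univ, true_and, Finset.mem_union, ← or_and_right]
    refine and_congr_left fun _ => ?_
    have e : p.1.val 0 < y.val 0 ↔ p.1.val 0 < x.val 0 ∨ p.1 = x := by
      constructor
      · intro hp
        rcases (show p.1.val 0 < x.val 0 ∨ p.1.val 0 = x.val 0 by omega) with h1 | h1
        · exact Or.inl h1
        · exact Or.inr (site_ext h1)
      · rintro (h1 | h1)
        · omega
        · rw [h1]; omega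
    rw [e]
    tauto
  · rw [Finset.disjoint_filter]
    rintro p - ⟨h1, -⟩ ⟨h2, -⟩
    rcases h2 with ⟨h2, h3⟩ | ⟨h2, h3⟩
    · rcases h1 with h1 | h1
      · rw [h2] at h1; omega
      · exact h3 h1.2
    · rcases h1 with h1 | h1
      · rw [h2] at h1; omega
      · exact hxy (h1.1.symm.trans h2)

/-- The modes before `(x, σ)` contribute their sign twice, so it cancels; what remains depends on
the occupations at `x` and `y` only. -/
theorem actsWithin_sign_of_succ {x y : Λ} (h : y.val 0 = x.val 0 + 1) (σ : Fin 2) :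
    ActsWithin {x, y} (Matrix.diagonal fun η : Λ → Fin 4 =>
      (-1 : ℂ) ^ occBefore η x σ * (-1 : ℂ) ^ occBefore η y σ) := by
  classical
  refine actsWithin_diagonal fun η ζ hηζ => ?_
  simp only [occBefore_succ _ h, pow_add]
  rw [← mul_assoc, ← mul_assoc, ← mul_pow, ← mul_pow]
  simp only [mul_neg, mul_one, neg_neg, one_pow, one_mul]
  congr 2
  refine Finset.filter_congr fun p _ => and_congr_right fun hp => ?_
  rw [hηζ p.1 (by rcases hp with hp | hp <;> simp [hp.1])]

theorem actsWithin_sign {x y : Λ} (h : (latticeGraph 1).Adj x.val y.val) (σ : Fin 2) :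
    ActsWithin {x, y} (Matrix.diagonal fun η : Λ → Fin 4 =>
      (-1 : ℂ) ^ occBefore η x σ * (-1 : ℂ) ^ occBefore η y σ) := by
  rw [adj_iff] at h
  rcases (abs_eq zero_le_one).1 h with h | h
  · have := actsWithin_sign_of_succ (x := y) (y := x) (by omega) σ
    rw [Finset.pair_comm]
    simpa only [mul_comm] using this
  · exact actsWithin_sign_of_succ (by omega) σ

theorem actsWithin_hop {x y : Λ} (h : (latticeGraph 1).Adj x.val y.val) (σ : Fin 2) :
    ActsWithin {x, y} (annih x σ * star (annih y σ)) := by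
  -- Both strings are evaluated at the same intermediate configuration, so they merge into the local
  -- sign of `actsWithin_sign`.
  have e : annih x σ * star (annih y σ) = lower x σ *
      (Matrix.diagonal fun η : Λ → Fin 4 =>
        (-1 : ℂ) ^ occBefore η x σ * (-1 : ℂ) ^ occBefore η y σ) * star (lower y σ) := by
    rw [annih_eq_lower_mul, annih_eq_lower_mul y, star_mul, ← Matrix.diagonal_mul_diagonal]
    have : star (Matrix.diagonal fun η : Λ → Fin 4 => (-1 : ℂ) ^ occBefore η y σ) =
        Matrix.diagonal fun η : Λ → Fin 4 => (-1 : ℂ) ^ occBefore η y σ := by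
      rw [Matrix.star_eq_conjTranspose, Matrix.diagonal_conjTranspose]
      congr 1
      funext η
      simp
    rw [this]
    simp only [mul_assoc]
  rw [e]
  exact mul_mem (S := Subalgebra ℂ (Op 4 Λ)) (s := localAlg 4 {x, y})
    (mul_mem (S := Subalgebra ℂ (Op 4 Λ)) (s := localAlg 4 {x, y})
      ((actsWithin_lower x σ).mono (by simp)) (actsWithin_sign h σ))
    (actsWithin_star ((actsWithin_lower y σ).mono (by simp)))

theorem isConn_pair {x y : Λ} (h : (latticeGraph 1).Adj x.val y.val) :
    IsConn ({x, y} : Finset Λ) := by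
  unfold IsConn
  rw [Finset.coe_pair]
  exact SimpleGraph.induce_pair_connected_of_adj h

theorem isPotential_hopping (J : ℝ) : IsPotential (hopping J : Finset Λ → Op 4 Λ) where
  actsWithin S := by
    refine (localAlg 4 S).smul_mem (sum_mem fun x _ => sum_mem fun y _ => ?_) _
    split_ifs with h
    · obtain ⟨h, rfl⟩ := h
      exact sum_mem fun σ _ => actsWithin_hop h σ
    · exact zero_mem _
  eq_zero S hS := by
    rw [hopping, Finset.sum_eq_zero, smul_zero]
    intro x _
    refine Finset.sum_eq_zero fun y _ => if_neg ?_
    rintro ⟨h, rfl⟩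
    exact hS (isConn_pair h)

theorem star_hopping (J : ℝ) (S : Finset Λ) : star (hopping J S) = hopping J S := by
  classical
  rw [hopping, star_smul, star_sum, Finset.sum_congr rfl fun x _ => star_sum _ _,
    Finset.sum_comm]
  congr 1
  · simp
  refine Finset.sum_congr rfl fun x _ => Finset.sum_congr rfl fun y _ => ?_
  by_cases h : (latticeGraph 1).Adj x.val y.val ∧ S = {x, y}
  · rw [if_pos h, if_pos ⟨h.1.symm, by rw [h.2, Finset.pair_comm]⟩, star_sum]
    refine Finset.sum_congr rfl fun σ _ => ?_
    rw [star_mul, star_star]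
  · rw [if_neg h, if_neg, star_zero]
    rintro ⟨h1, h2⟩
    exact h ⟨h1.symm, by rw [h2, Finset.pair_comm]⟩

theorem norm_hopping_le (J : ℝ) (S : Finset Λ) :
    open Classical in
    ‖hopping J S‖ ≤ |J| * ∑ x : Λ, ∑ y : Λ,
      if (latticeGraph 1).Adj x.val y.val ∧ S = {x, y} then (2 : ℝ) else 0 := by
  classical
  rw [hopping, norm_smul, Complex.norm_real, Real.norm_eq_abs]
  refine mul_le_mul_of_nonneg_left ?_ (abs_nonneg J)
  refine (norm_sum_le _ _).trans (Finset.sum_le_sum fun x _ => ?_)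
  refine (norm_sum_le _ _).trans (Finset.sum_le_sum fun y _ => ?_)
  split_ifs
  · refine (norm_sum_le _ _).trans ?_
    have h : ∀ σ : Fin 2, ‖annih x σ * star (annih y σ)‖ ≤ 1 := fun σ => by
      refine (norm_mul_le _ _).trans ?_
      rw [norm_star]
      exact mul_le_one₀ (norm_annih_le x σ) (norm_nonneg _) (norm_annih_le y σ)
    refine (Finset.sum_le_sum fun σ _ => h σ).trans ?_
    simp
  · simp

theorem sum_neighbours_le (x : Λ) :
    open Classical in
    ∑ y : Λ, (if (latticeGraph 1).Adj x.val y.val then (2 : ℝ) else 0) ≤ 4 := by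
  classical
  have h1 : ∀ n : ℤ, ∑ y : Λ, (if y.val 0 = n then (2 : ℝ) else 0) ≤ 2 := by
    intro n
    rw [← Finset.sum_filter, Finset.sum_const, nsmul_eq_mul]
    have : (Finset.univ.filter fun y : Λ => y.val 0 = n).card ≤ 1 := by
      rw [Finset.card_le_one]
      intro a ha b hb
      simp only [Finset.mem_filter, Finset.mem_univ, true_and] at ha hb
      exact site_ext (ha.trans hb.symm)
    have : ((Finset.univ.filter fun y : Λ => y.val 0 = n).card : ℝ) ≤ 1 := by exact_mod_cast this
    linarith
  calc _ ≤ ∑ y : Λ, ((if y.val 0 = x.val 0 + 1 then (2 : ℝ) else 0) +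
        (if y.val 0 = x.val 0 - 1 then (2 : ℝ) else 0)) := by
        refine Finset.sum_le_sum fun y _ => ?_
        by_cases h : (latticeGraph 1).Adj x.val y.val
        · rw [if_pos h]
          rw [adj_iff] at h
          rcases (abs_eq zero_le_one).1 h with h | h
          · rw [if_pos (show y.val 0 = x.val 0 - 1 by omega)]
            have : (0 : ℝ) ≤ if y.val 0 = x.val 0 + 1 then (2 : ℝ) else 0 := by
              split_ifs <;> norm_num
            linarith
          · rw [if_pos (show y.val 0 = x.val 0 + 1 by omega)]
            have : (0 : ℝ) ≤ if y.val 0 = x.val 0 - 1 then (2 : ℝ) else 0 := by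
              split_ifs <;> norm_num
            linarith
        · rw [if_neg h]
          split_ifs <;> norm_num
    _ ≤ 4 := by
        rw [Finset.sum_add_distrib]
        linarith [h1 (x.val 0 + 1), h1 (x.val 0 - 1)]

/-- The 8 counts two neighbours of `z`, two orders of the pair and two spins, each term having norm
at most `|J|`; a bond has at most two sites, hence `e^{2κ}`. -/
theorem siteSum_hopping_le {κ : ℝ} (hκ : 0 ≤ κ) (J : ℝ) (z : Λ) :
    siteSum κ z (hopping J) ≤ 8 * Real.exp (2 * κ) * |J| := by
  classical
  calc siteSum κ z (hopping J)
      ≤ ∑ S : Finset Λ, ∑ x : Λ, ∑ y : Λ, (if S = {x, y} then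
          (if (latticeGraph 1).Adj x.val y.val ∧ z ∈ ({x, y} : Finset Λ) then
            Real.exp (2 * κ) * |J| * 2 else 0) else 0) := by
        unfold siteSum
        refine Finset.sum_le_sum fun S _ => ?_
        split_ifs with hz
        · refine (mul_le_mul_of_nonneg_left (norm_hopping_le J S) (Real.exp_pos _).le).trans ?_
          rw [← mul_assoc, Finset.mul_sum]
          refine Finset.sum_le_sum fun x _ => ?_
          rw [Finset.mul_sum]
          refine Finset.sum_le_sum fun y _ => ?_
          by_cases hS : S = {x, y}
          · subst hS
            by_cases ha : (latticeGraph 1).Adj x.val y.val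
            · simp only [ha, hz, and_self, if_true]
              have hc : ((({x, y} : Finset Λ).card : ℕ) : ℝ) ≤ 2 := by
                exact_mod_cast Finset.card_le_two
              gcongr ?_ * _ * _
              refine Real.exp_le_exp.2 ?_
              nlinarith
            · simp [ha]
          · simp [hS]
        · refine Finset.sum_nonneg fun x _ => Finset.sum_nonneg fun y _ => ?_
          split_ifs <;> positivity
    _ = ∑ x : Λ, ∑ y : Λ, (if (latticeGraph 1).Adj x.val y.val ∧ z ∈ ({x, y} : Finset Λ) then
            Real.exp (2 * κ) * |J| * 2 else 0) := by
        rw [Finset.sum_comm]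
        refine Finset.sum_congr rfl fun x _ => ?_
        rw [Finset.sum_comm]
        refine Finset.sum_congr rfl fun y _ => ?_
        rw [Finset.sum_ite_eq', if_pos (Finset.mem_univ _)]
    _ ≤ ∑ x : Λ, ∑ y : Λ, Real.exp (2 * κ) * |J| *
          ((if x = z then (if (latticeGraph 1).Adj z.val y.val then 2 else 0) else 0) +
          (if y = z then (if (latticeGraph 1).Adj z.val x.val then 2 else 0) else 0)) := by
        refine Finset.sum_le_sum fun x _ => Finset.sum_le_sum fun y _ => ?_
        have hpos : 0 ≤ Real.exp (2 * κ) * |J| := by positivity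
        by_cases hxy : (latticeGraph 1).Adj x.val y.val ∧ z ∈ ({x, y} : Finset Λ)
        · rw [if_pos hxy]
          refine mul_le_mul_of_nonneg_left ?_ hpos
          obtain ⟨ha, hz⟩ := hxy
          rw [Finset.mem_insert, Finset.mem_singleton] at hz
          rcases hz with rfl | rfl
          · rw [if_pos rfl, if_pos ha]
            have : (0 : ℝ) ≤ if y = z then (if (latticeGraph 1).Adj z.val z.val then 2 else 0)
              else 0 := by split_ifs <;> norm_num
            linarith
          · rw [if_pos (rfl : z = z), if_pos ha.symm]
            have : (0 : ℝ) ≤ if x = z then (if (latticeGraph 1).Adj z.val z.val then 2 else 0)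
              else 0 := by split_ifs <;> norm_num
            linarith
        · rw [if_neg hxy]
          refine mul_nonneg hpos (add_nonneg ?_ ?_) <;> split_ifs <;> norm_num
    _ = Real.exp (2 * κ) * |J| * (∑ y : Λ, (if (latticeGraph 1).Adj z.val y.val then 2 else 0) +
          ∑ y : Λ, (if (latticeGraph 1).Adj z.val y.val then 2 else 0)) := by
        simp_rw [← Finset.mul_sum, Finset.sum_add_distrib]
        congr 2
        · rw [Finset.sum_comm]
          refine Finset.sum_congr rfl fun y _ => ?_
          rw [Finset.sum_ite_eq', if_pos (Finset.mem_univ _)]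
        · refine Finset.sum_congr rfl fun x _ => ?_
          rw [Finset.sum_ite_eq', if_pos (Finset.mem_univ _)]
    _ ≤ Real.exp (2 * κ) * |J| * (4 + 4) := by
        have := sum_neighbours_le z
        gcongr
    _ = _ := by ring

/-- The matrix entry from one `↑` particle at `x` to one at `y` receives a contribution only from
`c_{x,↑} c*_{y,↑}`, through the single intermediate state with both sites occupied. No cancellation
is possible, and the entry is a sign times `J`. -/
theorem hopping_pair_ne_zero {J : ℝ} (hJ : J ≠ 0) {x y : Λ}
    (h : (latticeGraph 1).Adj x.val y.val) : hopping J {x, y} ≠ 0 := by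
  classical
  have hxy : x ≠ y := by
    rintro rfl
    exact (latticeGraph 1).irrefl h
  have o1 : occ 1 0 = true := by decide
  have o2 : occ 1 1 = false := by decide
  have o3 : ∀ τ, occ 0 τ = false := by decide
  have hsingle : ∀ z z' : Λ, ∀ τ, occ ((Pi.single z 1 : Λ → Fin 4) z') τ = true ↔ (z', τ) = (z, 0) := by
    intro z z' τ
    by_cases hz : z' = z
    · subst hz
      rw [Pi.single_eq_same]
      fin_cases τ
      · simp [o1]
      · simp [o2]
    · rw [Pi.single_eq_of_ne hz]
      simp [o3, hz]
  set η : Λ → Fin 4 := Pi.single x 1 with hη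
  set η' : Λ → Fin 4 := Pi.single y 1 with hη'
  have entry : ∀ (a b : Λ) (σ : Fin 2), (annih a σ * star (annih b σ)) η' η =
      ∑ ζ, annih a σ η' ζ * star (annih b σ η ζ) := by
    intro a b σ
    rw [Matrix.mul_apply]; rfl
  have hzero : ∀ (a b : Λ) (σ : Fin 2), (annih a σ * star (annih b σ)) η' η ≠ 0 →
      a = x ∧ b = y ∧ σ = 0 := by
    intro a b σ hne
    rw [entry] at hne
    obtain ⟨ζ, -, hζ⟩ := Finset.exists_ne_zero_of_sum_ne_zero hne
    obtain ⟨p1, p2, p3⟩ := annih_ne_zero (left_ne_zero_of_mul hζ)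
    obtain ⟨r1, r2, r3⟩ := annih_ne_zero (star_ne_zero.1 (right_ne_zero_of_mul hζ))
    have k1 : (x, (0 : Fin 2)) = (a, σ) := by
      by_contra hc
      have hx1 : occ (η x) 0 = true := (hsingle x x 0).2 rfl
      have hb : (x, (0 : Fin 2)) ≠ (b, σ) := by
        intro hb
        obtain ⟨rfl, rfl⟩ := Prod.mk.inj hb
        rw [hx1] at r2; exact absurd r2 (by simp)
      have hx2 : occ (η' x) 0 = true := by rw [p3 x 0 hc, ← r3 x 0 hb, hx1]
      exact hxy (Prod.mk.inj ((hsingle y x 0).1 hx2)).1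
    have k2 : (y, (0 : Fin 2)) = (b, σ) := by
      by_contra hc
      have hx1 : occ (η' y) 0 = true := (hsingle y y 0).2 rfl
      have hb : (y, (0 : Fin 2)) ≠ (a, σ) := by
        intro hb
        obtain ⟨rfl, rfl⟩ := Prod.mk.inj hb
        rw [hx1] at p2; exact absurd p2 (by simp)
      have hx2 : occ (η y) 0 = true := by rw [r3 y 0 hc, ← p3 y 0 hb, hx1]
      exact hxy (Prod.mk.inj ((hsingle x y 0).1 hx2)).1.symm
    exact ⟨(Prod.mk.inj k1).1.symm, (Prod.mk.inj k2).1.symm, (Prod.mk.inj k1).2.symm⟩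
  have hmain : (annih x 0 * star (annih y 0)) η' η ≠ 0 := by
    set ζ : Λ → Fin 4 := fun z => if z = x ∨ z = y then 1 else 0 with hζ
    have hζo : ∀ z τ, occ (ζ z) τ = true ↔ (z, τ) = (x, 0) ∨ (z, τ) = (y, 0) := by
      intro z τ
      by_cases hz : z = x ∨ z = y
      · simp only [hζ, if_pos hz]
        fin_cases τ
        · simpa [o1] using hz
        · simp [o2]
      · simp only [hζ, if_neg hz]
        rw [not_or] at hz
        simp [o3, hz.1, hz.2]
    have bool_ext : ∀ {a b : Bool}, (a = true ↔ b = true) → a = b := by decide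
    have e1 : annih x 0 η' ζ = (-1 : ℂ) ^ occBefore ζ x 0 := by
      refine annih_of_occ ⟨(hζo x 0).2 (Or.inl rfl), ?_, fun z τ hz => bool_ext ?_⟩
      · rw [Bool.eq_false_iff]
        exact fun hc => hxy (Prod.mk.inj ((hsingle y x 0).1 hc)).1
      · rw [hsingle, hζo]; tauto
    have e2 : annih y 0 η ζ = (-1 : ℂ) ^ occBefore ζ y 0 := by
      refine annih_of_occ ⟨(hζo y 0).2 (Or.inr rfl), ?_, fun z τ hz => bool_ext ?_⟩
      · rw [Bool.eq_false_iff]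
        exact fun hc => hxy (Prod.mk.inj ((hsingle x y 0).1 hc)).1.symm
      · rw [hsingle, hζo]; tauto
    rw [entry, Finset.sum_eq_single ζ]
    · rw [e1, e2]; simp
    · intro ζ' _ hne
      by_contra hc
      obtain ⟨p1, p2, p3⟩ := annih_ne_zero (left_ne_zero_of_mul hc)
      have e1' : annih x 0 η' ζ ≠ 0 := by rw [e1]; simp
      obtain ⟨r1, r2, r3⟩ := annih_ne_zero e1'
      refine hne (conf_ext fun z τ => ?_)
      by_cases hz : (z, τ) = (x, 0)
      · obtain ⟨rfl, rfl⟩ := Prod.mk.inj hz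
        rw [p1, r1]
      · rw [← p3 z τ hz, ← r3 z τ hz]
    · intro hc; exact absurd (Finset.mem_univ _) hc
  intro h0
  apply hmain
  have h1 := congrFun (congrFun h0 η') η
  rw [hopping, Matrix.smul_apply, smul_eq_mul] at h1
  have h2 := (mul_eq_zero.1 h1).resolve_left (by exact_mod_cast hJ)
  rw [Matrix.sum_apply, Finset.sum_eq_single x, Matrix.sum_apply, Finset.sum_eq_single y,
    if_pos ⟨h, rfl⟩, Matrix.sum_apply, Finset.sum_eq_single 0] at h2
  · exact h2
  · intro σ _ hσ
    by_contra hc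
    exact hσ (hzero x y σ hc).2.2
  · intro hc; exact absurd (Finset.mem_univ _) hc
  · intro b _ hb
    split_ifs
    · rw [Matrix.sum_apply]
      refine Finset.sum_eq_zero fun σ _ => ?_
      by_contra hc
      exact hb (hzero x b σ hc).2.1
    · rfl
  · intro hc; exact absurd (Finset.mem_univ _) hc
  · intro a _ ha
    rw [Matrix.sum_apply]
    refine Finset.sum_eq_zero fun b _ => ?_
    split_ifs
    · rw [Matrix.sum_apply]
      refine Finset.sum_eq_zero fun σ _ => ?_
      by_contra hc
      exact ha (hzero a b σ hc).1
    · rfl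
  · intro hc; exact absurd (Finset.mem_univ _) hc

theorem potNorm_hopping_pos (κ₀ : ℝ) {J : ℝ} (hJ : J ≠ 0) {x y : Λ}
    (h : (latticeGraph 1).Adj x.val y.val) :
    0 < potNorm κ₀ (hopping J : Finset Λ → Op 4 Λ) := by
  refine lt_of_lt_of_le ?_ (siteSum_le (isPotential_hopping J) κ₀ x)
  classical
  have hne := norm_pos_iff.2 (hopping_pair_ne_zero hJ h)
  unfold siteSum
  refine Finset.sum_pos' (fun S _ => ?_) ⟨{x, y}, Finset.mem_univ _, ?_⟩
  · split_ifs
    · exact mul_nonneg (Real.exp_pos _).le (norm_nonneg _)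
    · exact le_rfl
  · rw [if_pos (by simp)]
    exact mul_pos (Real.exp_pos _) hne

/-- Since `H = D + V`, a nonzero `H` excludes `‖D‖ + 2‖V‖ = 0`. -/
theorem nuZero_hopping_pos {κ₀ : ℝ} (hκ₀ : 0 < κ₀) {J : ℝ} (hJ : J ≠ 0) {x y : Λ}
    (h : (latticeGraph 1).Adj x.val y.val) :
    0 < nuZero κ₀ (∑ x, doublon x : Op 4 Λ) (hopping J) := by
  have : Nonempty Λ := ⟨x⟩
  have hpi := Real.pi_pos
  have hpot := isPotential_hopping (Λ := Λ) J
  have hnum := isNumberFamily_doublon (Λ := Λ)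
  have h1 := potNorm_hopping_pos κ₀ hJ h
  have hD := hnum.isPotential_diagPart rfl hpot
  have hV := hnum.isPotential_offDiagPart rfl hpot
  have hs : diagPart (∑ x, doublon x) (hopping J) + offDiagPart (∑ x, doublon x) (hopping J) =
      (hopping J : Finset Λ → Op 4 Λ) :=
    funext fun S => add_sub_cancel _ _
  have h2 := potNorm_add_le κ₀ hD hV (hs.symm ▸ hpot)
  rw [hs] at h2
  have hv0 := potNorm_nonneg κ₀ (offDiagPart (∑ x, doublon x) (hopping J : Finset Λ → Op 4 Λ))
  exact mul_pos (by positivity) (by linarith)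

theorem exists_ratio_threshold :
    ∃ X : ℝ, 1 ≤ X ∧ ∀ r, X ≤ r → 1 ≤ ⌊r / (1 + Real.log r) ^ 3⌋ - 2 := by
  have h1 : (fun r : ℝ => (1 + Real.log r) ^ 3) =o[Filter.atTop] fun r : ℝ => r := by
    -- Comparison with `r^{1/3}` makes the cube `o(r)`; the bound `r/3` on it then yields a floor of
    -- at least 3.
    have h2 : (fun r : ℝ => 1 + Real.log r) =o[Filter.atTop] fun r : ℝ => r ^ (1 / 3 : ℝ) := by
      refine Asymptotics.IsLittleO.add ?_ (isLittleO_log_rpow_atTop (by norm_num))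
      refine (Asymptotics.isLittleO_const_left_of_ne one_ne_zero).2 ?_
      exact Filter.tendsto_abs_atTop_atTop.comp (tendsto_rpow_atTop (by norm_num))
    refine (h2.pow (n := 3) (by norm_num)).congr' Filter.EventuallyEq.rfl ?_
    filter_upwards [Filter.eventually_ge_atTop 0] with r hr
    rw [← Real.rpow_natCast, ← Real.rpow_mul hr]
    norm_num
  have h3 := h1.bound (show (0 : ℝ) < 1 / 3 by norm_num)
  obtain ⟨X, hX⟩ := Filter.eventually_atTop.1 h3
  refine ⟨max X 1, le_max_right _ _, fun r hr => ?_⟩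
  have hr1 : 1 ≤ r := (le_max_right _ _).trans hr
  have h4 := hX r ((le_max_left _ _).trans hr)
  have hl := Real.log_nonneg hr1
  have hpos : 0 < (1 + Real.log r) ^ 3 := by positivity
  rw [Real.norm_of_nonneg hpos.le, Real.norm_of_nonneg (by linarith)] at h4
  have h5 : (3 : ℤ) ≤ ⌊r / (1 + Real.log r) ^ 3⌋ := by
    rw [Int.le_floor, le_div_iff₀ hpos]
    push_cast
    linarith
  linarith

theorem admissible_hubbard {κ₀ : ℝ} (hκ₀ : 0 < κ₀) :
    ∃ c : ℝ, 0 < c ∧ ∀ (Λ : Volume 1) (_ : ∃ x ∈ Λ, ∃ y ∈ Λ, (latticeGraph 1).Adj x y)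
      (J U : ℝ) (_ : J ≠ 0) (_ : c * |J| ≤ U),
      Admissible (Λ := Λ) doublon (hopping J) κ₀ U := by
  have hpi := Real.pi_pos
  obtain ⟨X, hX1, hX⟩ := exists_ratio_threshold
  set b := 8 * Real.exp (2 * κ₀) with hb
  have hb0 : 0 < b := by positivity
  set c₁ := 9 * Real.pi * (2 * b) / κ₀ with hc₁
  -- With `‖H‖ ≤ b|J|` one has `‖D‖ ≤ b|J|` and `‖V‖ ≤ 2b|J|`, so `‖D‖ + 2‖V‖ ≤ 5b|J|`; the factor
  -- `X` brings `U/ν₀` above the threshold.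
  set c₂ := X * (54 * Real.pi / κ₀ ^ 2 * (5 * b)) with hc₂
  have hc₁0 : 0 < c₁ := by positivity
  have hc₂0 : 0 < c₂ := by positivity
  refine ⟨c₁ + c₂, by positivity, fun Λ hΛ J U hJ hU => ?_⟩
  obtain ⟨x, hx, y, hy, hxy⟩ := hΛ
  have : Nonempty Λ := ⟨⟨x, hx⟩⟩
  have hnum := isNumberFamily_doublon (Λ := Λ)
  have hpot := isPotential_hopping (Λ := Λ) J
  have hJ0 : 0 < |J| := abs_pos.2 hJ
  have hH : potNorm κ₀ (hopping J : Finset Λ → Op 4 Λ) ≤ b * |J| :=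
    potNorm_le hpot fun z => siteSum_hopping_le hκ₀.le J z
  set N : Op 4 Λ := ∑ x, doublon x with hN
  have hD := (hnum.potNorm_average_le hN κ₀ hpot).trans hH
  have hV : potNorm κ₀ (offDiagPart N (hopping J)) ≤ 2 * (b * |J|) :=
    (hnum.potNorm_offDiagPart_le hN κ₀ hpot).trans (by linarith)
  have hU1 : c₁ * |J| ≤ U := by nlinarith [mul_pos hc₂0 hJ0]
  have hU2 : c₂ * |J| ≤ U := by nlinarith [mul_pos hc₁0 hJ0]
  have hd0 := potNorm_nonneg κ₀ (diagPart N (hopping J))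
  have hv0 := potNorm_nonneg κ₀ (offDiagPart N (hopping J))
  have hnu : X * nuZero κ₀ N (hopping J) ≤ U := by
    refine le_trans ?_ hU2
    rw [nuZero, hc₂, mul_assoc X, mul_assoc (54 * Real.pi / κ₀ ^ 2)]
    have hX0 : 0 ≤ X := by linarith
    gcongr
    linarith
  have hpos : 0 < nuZero κ₀ N (hopping J) := nuZero_hopping_pos hκ₀ hJ (x := ⟨x, hx⟩) (y := ⟨y, hy⟩) hxy
  exact
    { number := hnum
      potential := hpot
      isHermitian := by
        change star (total (hopping J)) = total (hopping J)
        rw [total, star_sum]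
        exact Finset.sum_congr rfl fun S _ => star_hopping J S
      decay_pos := hκ₀
      scale_V := by
        refine le_trans ?_ hU1
        rw [hc₁, div_mul_eq_mul_div]
        have : 9 * Real.pi * (2 * b) * |J| = 9 * Real.pi * (2 * (b * |J|)) := by ring
        rw [this]
        gcongr
      scale_nuZero := by nlinarith
      one_le_nStar := hX _ (by rw [le_div_iff₀ hpos]; exact hnu) }

end Hubbard

end Prethermal

theorem theorem5 :
    (∃ C : ℝ, 0 < C ∧
      ∀ (d q : ℕ) (Λ : Prethermal.Volume d) (_ : Λ.Nonempty)
        (Nx : Λ → Prethermal.Op q Λ) (H : Finset Λ → Prethermal.Op q Λ) (κ₀ ν : ℝ)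
        (_ : Prethermal.Admissible Nx H κ₀ ν)
        (N : Prethermal.Op q Λ) (_ : N = ∑ x, Nx x)
        (Htot : Prethermal.Op q Λ) (_ : Htot = Prethermal.total H)
        (normD normV ν₀ : ℝ)
        (_ : normD = Prethermal.potNorm κ₀ (Prethermal.diagPart N H))
        (_ : normV = Prethermal.potNorm κ₀ (Prethermal.offDiagPart N H))
        (_ : ν₀ = Prethermal.nuZero κ₀ N H)
        (nst : ℤ) (_ : nst = Prethermal.nStar ν ν₀)
        (k : ℕ) (_ : (k : ℤ) = nst ∨ (k : ℤ) = nst + 1)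
        (𝒟 𝒩 : Prethermal.Op q Λ)
        (_ : 𝒟 = Prethermal.dressed ν N Htot k (Prethermal.effHam ν N Htot k))
        (_ : 𝒩 = Prethermal.dressed ν N Htot k N)
        (t : ℝ) (_ : 0 ≤ t),
        (1 / (Λ.card : ℝ)) *
            ‖star (Prethermal.evolution ν N Htot t) * 𝒟 * Prethermal.evolution ν N Htot t - 𝒟‖
          ≤ t * (C * (normD + ν₀ / ν * normV) * normV) * (2 / 3 : ℝ) ^ nst ∧
        (1 / (Λ.card : ℝ)) *
            ‖star (Prethermal.evolution ν N Htot t) * 𝒩 * Prethermal.evolution ν N Htot t - 𝒩‖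
          ≤ t * (C * (⨆ x, ‖Nx x‖) * normV) * (2 / 3 : ℝ) ^ nst) ∧
    (∀ κ₀ : ℝ, 0 < κ₀ → ∃ c : ℝ, 0 < c ∧
      ∀ (Λ : Prethermal.Volume 1)
        (_ : ∃ x ∈ Λ, ∃ y ∈ Λ, (Prethermal.latticeGraph 1).Adj x y)
        (J U : ℝ) (_ : J ≠ 0) (_ : c * |J| ≤ U),
        Prethermal.Admissible (Λ := Λ) Prethermal.doublon (Prethermal.hopping J) κ₀ U) := by
  -- The constant 6 is 2 from the commutator times 3 from `‖D_k‖ ≤ ‖D‖ + 3(ν₀/ν)‖V‖`; for the number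
  -- operator 2 would suffice.
  refine ⟨⟨6, by norm_num, ?_⟩, fun κ₀ hκ₀ => Prethermal.admissible_hubbard hκ₀⟩
  rintro d q Λ hΛ Nx H κ₀ ν hadm N hN _ rfl _ _ _ rfl rfl rfl _ rfl k hk _ _ rfl rfl t ht
  exact Prethermal.dressed_conservation hΛ hadm hN hk ht
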